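/- **Rosenthal-type inequality.** There is an absolute constant $c_0>0$ such that the following holds. Let $p\ge 2$ be real, $d\in\mathbb N$, and let $\|\cdot\|$ be the Euclidean norm on $\mathbb R^d$ (and the operator norm on multilinear forms). Let $f:\mathbb R^d\to\mathbb R$ have the minimizer $\theta^\star$, let $\mathbb P_\xi$ be a probability measure on a measurable space $\mathsf Z$, and let $\nabla F:\mathbb R^d\times\mathsf Z\to\mathbb R^d$ be a jointly measurable stochastic gradient. Assume: 1. (strong convexity) $f$ is continuously differentiable, $\mu>0$, and $\frac\mu2\|\theta-\theta'\|^2\le f(\theta)-f(\theta')-\langle\nabla f(\theta'),\theta-\theta'\rangle$ for all $\theta,\theta'$. 2. (smoothness) $f$ is four times continuously differentiable, $\|\nabla f(\theta)-\nabla f(\theta')\|\le L_2\|\theta-\theta'\|$ and $\|\nabla^i f(\theta)\|\le L_i$, $i\in\{3,4\}$, for all $\theta,\theta'$, with constants $L_2,L_3,L_4\ge0$. 3. (noise, $\mathrm A(2p)$) $\mathsf E_{\xi\sim\mathbb P_\xi}[\nabla F(\theta,\xi)]=\nabla f(\theta)$ for all $\theta$; $\mathsf E^{1/(2p)}[\|\nabla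 F(\theta^\star,\xi)\|^{2p}]\le\tau_{2p}$; and, for some $L_1>0$, every integer $2\le q\le 2p$ and all $\theta_1,\theta_2$, $$\mathsf E\bigl[\|\nabla F(\theta_1,\xi)-\nabla F(\theta_2,\xi)\|^q\bigr]\le L_1^{q-1}\|\theta_1-\theta_2\|^{q-2}\langle\nabla f(\theta_1)-\nabla f(\theta_2),\theta_1-\theta_2\rangle .$$ Put $L=\max(L_1,L_2,L_3,L_4)$. For $\gamma>0$ let $\theta_{k+1}^{(\gamma)}=\theta_k^{(\gamma)}-\gamma\nabla F(\theta_k^{(\gamma)},\xi_{k+1})$, where $(\xi_k)_{k\ge1}$ is i.i.d. with law $\mathbb P_\xi$ and independent of $\theta_0^{(\gamma)}=\theta_0$; write $\mathsf E_\nu$ for the expectation when $\theta_0\sim\nu$, and $Q_\gamma(\theta,A)=\mathbb P_\xi(\theta-\gamma\nabla F(\theta,\xi)\in A)$ for the Markov kernel of this chain. 4. (moments, $\mathrm C(2p)$) There are constants $\mathsf D_{2p}\ge2$ and $\mathsf C_{2p}\ge2$ such that for all $\gamma\in(0,1/(L\mathsf C_{2p})]$, all probability measures $\nu$ on $\mathbb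 R^d$ and all $k\in\mathbb N$, $$\mathsf E_\nu^{1/p}\bigl[\|\theta_k^{(\gamma)}-\theta^\star\|^{2p}\bigr]\le(1-\gamma\mu)^k\,\mathsf E_\nu^{1/p}\bigl[\|\theta_0-\theta^\star\|^{2p}\bigr]+\mathsf D_{2p}\gamma\tau_{2p}^2/\mu,$$ and $\bigl(\int\|\theta-\theta^\star\|^{2p}\,\pi_\gamma(\mathrm d\theta)\bigr)^{1/p}\le\mathsf D_{2p}\gamma\tau_{2p}^2/\mu$ for the invariant distribution $\pi_\gamma$ of $Q_\gamma$. Let $\psi(\theta)=\frac12\nabla^3f(\theta^\star)(\theta-\theta^\star)^{\otimes2}\in\mathbb R^d$, i.e. $\psi(\theta)_l=\frac12\sum_{i,j}\partial_i\partial_j\partial_lf(\theta^\star)(\theta-\theta^\star)_i(\theta-\theta^\star)_j$. Then for every $\gamma\in(0,1/(L\mathsf C_{2p})]$, with $\pi_\gamma$ the invariant distribution of $Q_\gamma$, $\psi$ is $\pi_\gamma$-integrable and, with $\pi_\gamma(\psi)=\int\psi\,\mathrm d\pi_\gamma$, for every $n\in\mathbb N$, $$\mathsf E_{\pi_\gamma}^{1/p}\Bigl[\Bigl\|\sum_{k=0}^{n-1}\bigl\{\psi(\theta_k^{(\gamma)})-\pi_\gamma(\psi)\bigr\}\Bigr\|^p\Bigr]\le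 c_0\left(\frac{L\,\mathsf D_{2p}\,p\,\tau_{2p}^2\sqrt{n\gamma}}{\mu^{3/2}}+\frac{L\,\mathsf D_{2p}\,\tau_{2p}}{\mu^2}\right).$$ -/

import Mathlib

open MeasureTheory ProbabilityTheory
open scoped ENNReal

noncomputable section

namespace SGD

variable {d : ℕ} {Z : Type*} [MeasurableSpace Z]

/-- Strong convexity with modulus `μ > 0` of a continuously differentiable function. -/
structure StronglyConvex (f : EuclideanSpace ℝ (Fin d) → ℝ) (μ : ℝ) : Prop where
  contDiff : ContDiff ℝ 1 f
  pos : 0 < μ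
  lower_bound : ∀ θ θ' : EuclideanSpace ℝ (Fin d),
    μ / 2 * ‖θ - θ'‖ ^ 2 ≤ f θ - f θ' - inner ℝ (gradient f θ') (θ - θ')

/-- `f` is four times continuously differentiable, its gradient is `L₂`-Lipschitz, and its third and
fourth derivatives are uniformly bounded by `L₃` and `L₄`. -/
structure Smooth (f : EuclideanSpace ℝ (Fin d) → ℝ) (L₂ L₃ L₄ : ℝ) : Prop where
  contDiff : ContDiff ℝ 4 f
  L₂_nonneg : 0 ≤ L₂
  L₃_nonneg : 0 ≤ L₃
  L₄_nonneg : 0 ≤ L₄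
  gradient_lipschitz : ∀ θ θ' : EuclideanSpace ℝ (Fin d),
    ‖gradient f θ - gradient f θ'‖ ≤ L₂ * ‖θ - θ'‖
  third_derivative_le : ∀ θ, ‖iteratedFDeriv ℝ 3 f θ‖ ≤ L₃
  fourth_derivative_le : ∀ θ, ‖iteratedFDeriv ℝ 4 f θ‖ ≤ L₄

/-- The noise condition of order `p` for the stochastic gradient `G θ z` (written `∇F(θ, z)`) when
`z` has law `P`: it is unbiased, its `p`-th moment at `θstar` is controlled by `τ`, and it is
co-coercive in every integer order `q` from `2` to `p`. -/
structure NoiseCondition (p : ℝ) (f : EuclideanSpace ℝ (Fin d) → ℝ)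
    (G : EuclideanSpace ℝ (Fin d) → Z → EuclideanSpace ℝ (Fin d)) (P : Measure Z)
    (θstar : EuclideanSpace ℝ (Fin d)) (L₁ τ : ℝ) : Prop where
  measurable : Measurable (Function.uncurry G)
  integrable : ∀ θ, Integrable (G θ) P
  unbiased : ∀ θ, ∫ z, G θ z ∂P = gradient f θ
  τ_nonneg : 0 ≤ τ
  moment : eLpNorm (G θstar) (ENNReal.ofReal p) P ≤ ENNReal.ofReal τ
  L₁_pos : 0 < L₁
  cocoercive : ∀ q : ℕ, 2 ≤ q → (q : ℝ) ≤ p → ∀ θ₁ θ₂ : EuclideanSpace ℝ (Fin d),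
    ∫⁻ z, ‖G θ₁ z - G θ₂ z‖ₑ ^ q ∂P ≤
      ENNReal.ofReal (L₁ ^ (q - 1) * ‖θ₁ - θ₂‖ ^ (q - 2) *
        inner ℝ (gradient f θ₁ - gradient f θ₂) (θ₁ - θ₂))

/-- The Markov kernel `Q_γ` of the SGD recursion with step size `γ`:
`Q_γ(θ, A) = P {z | θ - γ G(θ, z) ∈ A}`. -/
def kernel (G : EuclideanSpace ℝ (Fin d) → Z → EuclideanSpace ℝ (Fin d)) (P : Measure Z)
    [IsProbabilityMeasure P] (γ : ℝ) :
    Kernel (EuclideanSpace ℝ (Fin d)) (EuclideanSpace ℝ (Fin d)) :=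
  (Kernel.id ×ₖ Kernel.const (EuclideanSpace ℝ (Fin d)) P).map (fun x => x.1 - γ • G x.1 x.2)

theorem kernel_apply (G : EuclideanSpace ℝ (Fin d) → Z → EuclideanSpace ℝ (Fin d)) (P : Measure Z)
    [IsProbabilityMeasure P] (γ : ℝ) (hG : Measurable (Function.uncurry G))
    (θ : EuclideanSpace ℝ (Fin d)) :
    kernel G P γ θ = P.map (fun z => θ - γ • G θ z) := by
  have hm : Measurable (fun x : EuclideanSpace ℝ (Fin d) × Z => x.1 - γ • G x.1 x.2) :=
    measurable_fst.sub (hG.const_smul γ)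
  rw [kernel, Kernel.map_apply _ hm, Kernel.prod_apply, Kernel.id_apply, Kernel.const_apply,
    Measure.dirac_prod, Measure.map_map hm (by fun_prop)]
  rfl

/-- The SGD iterates `θ_{k+1} = θ_k - γ G(θ_k, ξ_{k+1})`, as functions of the pair `ω` of the initial
point `ω.1 = θ_0` and the noise sequence, whose `k`-th entry `ω.2 k` is `ξ_{k+1}`. -/
def iterate (G : EuclideanSpace ℝ (Fin d) → Z → EuclideanSpace ℝ (Fin d)) (γ : ℝ)
    (ω : EuclideanSpace ℝ (Fin d) × (ℕ → Z)) : ℕ → EuclideanSpace ℝ (Fin d)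
  | 0 => ω.1
  | k + 1 => iterate G γ ω k - γ • G (iterate G γ ω k) (ω.2 k)

/-- The canonical probability: `θ_0` has law `ν`, the noise variables are i.i.d. with law `P` and
independent of `θ_0`. Expectation under it is written `E_ν`. -/
def canonicalMeasure (ν : Measure (EuclideanSpace ℝ (Fin d))) (P : Measure Z)
    [IsProbabilityMeasure P] : Measure (EuclideanSpace ℝ (Fin d) × (ℕ → Z)) :=
  ν.prod (Measure.infinitePi (fun _ : ℕ => P))

/-- The moment condition of order `p` with constants `D` and `C`: for all step sizes
`γ ∈ (0, 1 / (L C)]`, the `p`-th moments of the SGD iterates, from any initial distribution, and of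
the stationary distributions of `Q_γ` are controlled. -/
structure MomentCondition (p : ℝ)
    (G : EuclideanSpace ℝ (Fin d) → Z → EuclideanSpace ℝ (Fin d)) (P : Measure Z)
    [IsProbabilityMeasure P] (θstar : EuclideanSpace ℝ (Fin d)) (μ L τ D C : ℝ) : Prop where
  two_le_D : 2 ≤ D
  two_le_C : 2 ≤ C
  iterate_bound : ∀ γ : ℝ, 0 < γ → γ ≤ 1 / (L * C) →
    ∀ ν : Measure (EuclideanSpace ℝ (Fin d)), IsProbabilityMeasure ν → ∀ k : ℕ,
      eLpNorm (fun ω => iterate G γ ω k - θstar) (ENNReal.ofReal p) (canonicalMeasure ν P) ^ 2 ≤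
        ENNReal.ofReal ((1 - γ * μ) ^ k) *
            eLpNorm (fun θ => θ - θstar) (ENNReal.ofReal p) ν ^ 2 +
          ENNReal.ofReal (D * γ * τ ^ 2 / μ)
  stationary_bound : ∀ γ : ℝ, 0 < γ → γ ≤ 1 / (L * C) →
    ∀ π : Measure (EuclideanSpace ℝ (Fin d)), IsProbabilityMeasure π →
      (kernel G P γ).Invariant π →
      eLpNorm (fun θ => θ - θstar) (ENNReal.ofReal p) π ^ 2 ≤
        ENNReal.ofReal (D * γ * τ ^ 2 / μ)

/-- The quadratic function `ψ(θ) = (1/2) ∇³f(θ*) (θ - θ*)^{⊗2}`, whose `l`-th coordinate is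
`(1/2) ∑_{i,j} ∂_i ∂_j ∂_l f(θ*) (θ - θ*)_i (θ - θ*)_j`. -/
def psi (f : EuclideanSpace ℝ (Fin d) → ℝ) (θstar θ : EuclideanSpace ℝ (Fin d)) :
    EuclideanSpace ℝ (Fin d) :=
  WithLp.toLp 2 fun l : Fin d =>
    1 / 2 * iteratedFDeriv ℝ 3 f θstar ![θ - θstar, θ - θstar, EuclideanSpace.single l 1]

end SGD

end

/-! The sums are handled by a Poisson-equation argument in the style of Rio's moment inequality. Put
h = ψ - π(ψ), x = γμ, and let g_N = ∑_{j<N} Q^j h be the truncated Poisson solution (`poissonSum`).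

Two copies of the chain driven by the same noise contract in mean square at rate 1 - x, while the
squared distance to the minimizer has bounded drift. The quadratic ψ is Lipschitz for the cost ‖θ -
θ'‖ times a square root of second moments. Q shrinks the corresponding modulus by 1 - x/4
(`hasModulus_markovOp`), so all g_N share one modulus of order 1/x. Since h and g_N have π-mean
zero, this bounds h by an envelope v(θ) of order ‖θ - θ*‖² + s, and g_N by 4v/x.

Let S_k = ∑_{j<k} h(θ_j). The potential E[‖S_k‖^p + ⟨∇‖·‖^p(S_k), g_N(θ_k)⟩] changes only by a
second-order remainder when (k, N+1) becomes (k+1, N): averaging over fresh noise turns g_N(θ_{k+1})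
into Q g_N(θ_k) = g_{N+1}(θ_k) - h(θ_k), which cancels the first-order increment of ‖S_k‖^p.
Telescoping bounds E‖S_n‖^p by the remainders, and strong induction on n closes the estimate at
order p √(n/x) ‖v‖_p (`integral_partialSum_le`). With s = Dγτ²/μ this is the first term of the
claimed bound. -/

namespace SGD

/-! ### Power inequalities and the second-order expansion of ‖·‖^p -/

section PowerInequalities

/-- The tangent line inequality for `t ↦ t ^ r`, `r ≥ 1`. -/
theorem rpow_sub_rpow_le {a b r : ℝ} (ha : 0 ≤ a) (hb : 0 ≤ b) (hr : 1 ≤ r) :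
    b ^ r - a ^ r ≤ r * b ^ (r - 1) * (b - a) := by
  rcases hb.eq_or_lt with rfl | hb
  · rcases hr.eq_or_lt with rfl | hr
    · simp
    · rw [Real.zero_rpow (by linarith), Real.zero_rpow (by linarith)]
      simp only [mul_zero, zero_mul, zero_sub, neg_nonpos]
      positivity
  · have h := one_add_mul_self_le_rpow_one_add (s := a / b - 1)
      (by linarith [div_nonneg ha hb.le]) hr
    rw [add_sub_cancel, Real.div_rpow ha hb.le, le_div_iff₀ (Real.rpow_pos_of_pos hb r)] at h
    have h2 : b ^ r = b ^ (r - 1) * b := by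
      rw [← Real.rpow_add_one hb.ne', sub_add_cancel]
    have h3 : (1 + r * (a / b - 1)) * b ^ r = b ^ r + r * b ^ (r - 1) * (a - b) := by
      rw [h2]; field_simp
    linarith

theorem rpow_sub_two_mul_self {m p : ℝ} (hm : 0 ≤ m) (hp : 2 ≤ p) :
    m ^ (p - 2) * m = m ^ (p - 1) := by
  rw [show p - 1 = p - 2 + 1 by ring, Real.rpow_add_of_nonneg hm (by linarith) zero_le_one,
    Real.rpow_one]

/-- Convexity with weights p/(p+1) and 1/(p+1), chosen so that the factor on a^p is (1 + 1/p)^p ≤ e.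
An absolute constant here, instead of 2^(p-1), keeps the final bound linear in p. -/
theorem add_rpow_le {a v p : ℝ} (ha : 0 ≤ a) (hv : 0 ≤ v) (hp : 1 ≤ p) :
    (a + v) ^ p ≤ 3 * a ^ p + ((1 + p) * v) ^ p := by
  have hp0 : 0 < p := by linarith
  have h := (convexOn_rpow hp).2
    (show (1 + 1 / p) * a ∈ Set.Ici 0 from Set.mem_Ici.2 (by positivity))
    (show (1 + p) * v ∈ Set.Ici 0 from Set.mem_Ici.2 (by positivity))
    (show 0 ≤ p / (p + 1) by positivity) (show 0 ≤ 1 / (p + 1) by positivity) (by field_simp)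
  simp only [smul_eq_mul] at h
  have e : p / (p + 1) * ((1 + 1 / p) * a) + 1 / (p + 1) * ((1 + p) * v) = a + v := by
    field_simp; ring
  rw [e, Real.mul_rpow (x := 1 + 1 / p) (by positivity) ha] at h
  have h1 : (1 + 1 / p) ^ p ≤ 3 := by
    calc (1 + 1 / p) ^ p ≤ (Real.exp (1 / p)) ^ p := by
          gcongr; linarith [Real.add_one_le_exp (1 / p)]
      _ = Real.exp 1 := by rw [← Real.exp_mul]; congr 1; field_simp
      _ ≤ 3 := by linarith [Real.exp_one_lt_d9]
  have h2 : p / (p + 1) ≤ 1 := by rw [div_le_one (by positivity)]; linarith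
  have h3 : 1 / (p + 1) ≤ 1 := by rw [div_le_one (by positivity)]; linarith
  have h4 : 0 ≤ a ^ p := by positivity
  have h5 : 0 ≤ ((1 + p) * v) ^ p := by positivity
  calc (a + v) ^ p ≤ _ := h
    _ ≤ 1 * (3 * a ^ p) + 1 * ((1 + p) * v) ^ p := by gcongr
    _ = _ := by ring

/-- A crude form of Young's inequality: the larger of u and w dominates the product. -/
theorem rpow_sub_two_mul_sq_le {u w p : ℝ} (hu : 0 ≤ u) (hw : 0 ≤ w) (hp : 2 ≤ p) :
    u ^ (p - 2) * w ^ 2 ≤ u ^ p + w ^ p := by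
  have key : ∀ m : ℝ, 0 ≤ m → m ^ (p - 2) * m ^ 2 = m ^ p := by
    intro m hm
    rw [← Real.rpow_natCast, ← Real.rpow_add_of_nonneg hm (by linarith) (by norm_num)]
    norm_num
  rcases le_total u w with h | h
  · calc u ^ (p - 2) * w ^ 2 ≤ w ^ (p - 2) * w ^ 2 := by
          gcongr
      _ = w ^ p := key w hw
      _ ≤ _ := by linarith [Real.rpow_nonneg hu p]
  · calc u ^ (p - 2) * w ^ 2 ≤ u ^ (p - 2) * u ^ 2 := by gcongr
      _ = u ^ p := key u hu
      _ ≤ _ := by linarith [Real.rpow_nonneg hw p]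

variable {F : Type*} [NormedAddCommGroup F] [InnerProductSpace ℝ F]

/-- The gradient of `x ↦ ‖x‖ ^ p`. -/
noncomputable def normPowGrad (p : ℝ) (s : F) : F := (p * ‖s‖ ^ (p - 2)) • s

theorem norm_normPowGrad {p : ℝ} (hp : 2 ≤ p) (s : F) :
    ‖normPowGrad p s‖ = p * ‖s‖ ^ (p - 1) := by
  rw [normPowGrad, norm_smul, Real.norm_of_nonneg (by positivity), mul_assoc,
    rpow_sub_two_mul_self (norm_nonneg s) hp]

theorem norm_rpow_sub_le_inner {p : ℝ} (hp : 2 ≤ p) (y s : F) :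
    ‖y‖ ^ p - ‖s‖ ^ p ≤ inner ℝ (normPowGrad p y) (y - s) := by
  have h := rpow_sub_rpow_le (norm_nonneg s) (norm_nonneg y) (r := p) (by linarith)
  rw [← rpow_sub_two_mul_self (norm_nonneg y) hp] at h
  refine h.trans ?_
  rw [normPowGrad, real_inner_smul_left, inner_sub_right, real_inner_self_eq_norm_sq]
  have h2 := real_inner_le_norm y s
  have h3 : 0 ≤ p * ‖y‖ ^ (p - 2) := by positivity
  nlinarith [mul_le_mul_of_nonneg_left h2 h3]

/-- This replaces a Hessian bound for ‖·‖^p. The difference is split into a change of direction and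
a change of the scalar weight; the latter is controlled by the tangent inequality for t^(p-1). -/
theorem norm_normPowGrad_sub_le_of_norm_le {p : ℝ} (hp : 2 ≤ p) {y s : F} (h : ‖s‖ ≤ ‖y‖) :
    ‖normPowGrad p y - normPowGrad p s‖ ≤ p ^ 2 * ‖y‖ ^ (p - 2) * ‖y - s‖ := by
  have e : normPowGrad p y - normPowGrad p s =
      (p * ‖y‖ ^ (p - 2)) • (y - s) + (p * (‖y‖ ^ (p - 2) - ‖s‖ ^ (p - 2))) • s := by
    simp only [normPowGrad]; module
  have hm : ‖s‖ ^ (p - 2) ≤ ‖y‖ ^ (p - 2) := by gcongr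
  have h1 := rpow_sub_rpow_le (norm_nonneg s) (norm_nonneg y) (r := p - 1) (by linarith)
  rw [← rpow_sub_two_mul_self (norm_nonneg s) hp, ← rpow_sub_two_mul_self (norm_nonneg y) hp,
    show p - 1 - 1 = p - 2 by ring] at h1
  have h2 : ‖y‖ - ‖s‖ ≤ ‖y - s‖ := norm_sub_norm_le y s
  have hy : 0 ≤ ‖y‖ ^ (p - 2) := by positivity
  rw [e]
  refine (norm_add_le _ _).trans ?_
  rw [norm_smul, norm_smul, Real.norm_of_nonneg (by positivity),
    Real.norm_of_nonneg (mul_nonneg (by linarith) (by linarith))]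
  have h3 : (‖y‖ ^ (p - 2) - ‖s‖ ^ (p - 2)) * ‖s‖ ≤ (p - 1) * ‖y‖ ^ (p - 2) * (‖y‖ - ‖s‖) := by
    nlinarith [mul_nonneg hy (sub_nonneg.2 h)]
  have h4 : (p - 1) * ‖y‖ ^ (p - 2) * (‖y‖ - ‖s‖) ≤ (p - 1) * ‖y‖ ^ (p - 2) * ‖y - s‖ := by
    have : 0 ≤ p - 1 := by linarith
    gcongr
  have h5 := mul_le_mul_of_nonneg_left (h3.trans h4) (show 0 ≤ p by linarith)
  linarith

theorem norm_normPowGrad_sub_le {p : ℝ} (hp : 2 ≤ p) (s x : F) :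
    ‖normPowGrad p (s + x) - normPowGrad p s‖ ≤ p ^ 2 * (‖s‖ + ‖x‖) ^ (p - 2) * ‖x‖ := by
  rcases le_total ‖s‖ ‖s + x‖ with h | h
  · refine (norm_normPowGrad_sub_le_of_norm_le hp h).trans ?_
    rw [add_sub_cancel_left]
    gcongr
    exact norm_add_le s x
  · rw [norm_sub_rev]
    refine (norm_normPowGrad_sub_le_of_norm_le hp h).trans ?_
    rw [norm_sub_rev, add_sub_cancel_left]
    gcongr
    linarith [norm_nonneg x]

/-- Convexity bounds the increment of ‖·‖^p by the gradient at the new point s + x. Moving that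
gradient back to s, against x and u together, costs only a second-order term. With x = h(θ) and u =
Q g(θ), the sum x + u is the next Poisson sum. -/
theorem norm_add_rpow_add_inner_le {p : ℝ} (hp : 2 ≤ p) (s x u : F) :
    ‖s + x‖ ^ p + inner ℝ (normPowGrad p (s + x)) u ≤
      ‖s‖ ^ p + inner ℝ (normPowGrad p s) (x + u) +
        p ^ 2 * (‖s‖ + ‖x‖) ^ (p - 2) * ‖x‖ * (‖x‖ + ‖u‖) := by
  have h1 := norm_rpow_sub_le_inner hp (s + x) s
  rw [add_sub_cancel_left] at h1
  have h2 := norm_normPowGrad_sub_le hp s x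
  have h3 : inner ℝ (normPowGrad p (s + x) - normPowGrad p s) (x + u) ≤
      p ^ 2 * (‖s‖ + ‖x‖) ^ (p - 2) * ‖x‖ * (‖x‖ + ‖u‖) :=
    (real_inner_le_norm _ _).trans (mul_le_mul h2 (norm_add_le x u) (norm_nonneg _) (by positivity))
  rw [inner_sub_left] at h3
  rw [inner_add_right (normPowGrad p (s + x))] at h3
  linarith

end PowerInequalities

/-! ### Resampling one noise variable, and stationarity of the chain -/

section Iterates

variable {d : ℕ} {Z : Type*} {G : EuclideanSpace ℝ (Fin d) → Z → EuclideanSpace ℝ (Fin d)} {γ : ℝ}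

/-- One step of the recursion. -/
def step (G : EuclideanSpace ℝ (Fin d) → Z → EuclideanSpace ℝ (Fin d)) (γ : ℝ)
    (θ : EuclideanSpace ℝ (Fin d)) (z : Z) : EuclideanSpace ℝ (Fin d) := θ - γ • G θ z

theorem iterate_succ (ω : EuclideanSpace ℝ (Fin d) × (ℕ → Z)) (k : ℕ) :
    iterate G γ ω (k + 1) = step G γ (iterate G γ ω k) (ω.2 k) := rfl

/-- θ_j depends only on the noise entries with index below j, so entry k is still fresh at time k.
-/
theorem iterate_update (ω : EuclideanSpace ℝ (Fin d) × (ℕ → Z)) (z : Z) {j k : ℕ} (h : j ≤ k) :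
    iterate G γ (ω.1, Function.update ω.2 k z) j = iterate G γ ω j := by
  induction j with
  | zero => rfl
  | succ j ih =>
    rw [iterate_succ, iterate_succ, ih (by omega)]
    simp [Function.update_of_ne (show j ≠ k by omega)]

variable [MeasurableSpace Z]

/-- Replacing one coordinate by an independent copy preserves the product law. This does the work of
conditional expectation: integrating out the new copy averages over one noise variable. -/
theorem measurePreserving_update_infinitePi (P : Measure Z) [IsProbabilityMeasure P] (k : ℕ) :
    MeasurePreserving (fun q : (ℕ → Z) × Z => Function.update q.1 k q.2)
      ((Measure.infinitePi fun _ => P).prod P) (Measure.infinitePi fun _ => P) := by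
  have hm : Measurable (fun q : (ℕ → Z) × Z => Function.update q.1 k q.2) := by
    fun_prop
  refine ⟨hm, Measure.eq_infinitePi _ fun s t ht => ?_⟩
  have hs : MeasurableSet ((s : Set ℕ).pi t) := MeasurableSet.pi s.countable_toSet fun i _ => ht i
  rw [Measure.map_apply hm hs]
  have e : (fun q : (ℕ → Z) × Z => Function.update q.1 k q.2) ⁻¹' ((s : Set ℕ).pi t) =
      ((s.erase k : Finset ℕ) : Set ℕ).pi t ×ˢ (if k ∈ s then t k else Set.univ) := by
    ext ⟨w, z⟩
    simp only [Set.mem_preimage, Set.mem_pi, Set.mem_prod, Finset.mem_coe, Finset.mem_erase]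
    constructor
    · refine fun h => ⟨fun i hi => by simpa [hi.1] using h i hi.2, ?_⟩
      split_ifs with hk
      · simpa using h k hk
      · trivial
    · rintro ⟨h1, h2⟩ i hi
      by_cases hik : i = k
      · subst hik; simpa [hi] using h2
      · simpa [hik] using h1 i ⟨hik, hi⟩
  rw [e, Measure.prod_prod, Measure.infinitePi_pi _ (fun i _ => ht i)]
  split_ifs with hk
  · rw [Finset.prod_erase_mul _ _ hk]
  · simp [hk]

theorem measurePreserving_resample (ν : Measure (EuclideanSpace ℝ (Fin d)))
    [IsProbabilityMeasure ν] (P : Measure Z) [IsProbabilityMeasure P] (k : ℕ) :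
    MeasurePreserving
      (fun q : (EuclideanSpace ℝ (Fin d) × (ℕ → Z)) × Z => (q.1.1, Function.update q.1.2 k q.2))
      ((canonicalMeasure ν P).prod P) (canonicalMeasure ν P) := by
  unfold canonicalMeasure
  have h1 := (MeasurePreserving.id ν).prod (measurePreserving_update_infinitePi P k)
  exact h1.comp (measurePreserving_prodAssoc ν (Measure.infinitePi fun _ => P) P)

instance (ν : Measure (EuclideanSpace ℝ (Fin d))) [IsProbabilityMeasure ν] (P : Measure Z)
    [IsProbabilityMeasure P] : IsProbabilityMeasure (canonicalMeasure ν P) := by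
  unfold canonicalMeasure; infer_instance

theorem measurable_step (hG : Measurable (Function.uncurry G)) :
    Measurable (Function.uncurry (step G γ)) :=
  measurable_fst.sub (hG.const_smul γ)

theorem measurable_step_right (hG : Measurable (Function.uncurry G))
    (θ : EuclideanSpace ℝ (Fin d)) : Measurable (step G γ θ) :=
  (measurable_step hG).comp measurable_prodMk_left

theorem measurable_iterate (hG : Measurable (Function.uncurry G)) (k : ℕ) :
    Measurable fun ω => iterate G γ ω k := by
  induction k with
  | zero => exact measurable_fst
  | succ k ih =>
    exact (measurable_step hG).comp
      (ih.prodMk ((measurable_pi_apply k).comp measurable_snd))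

theorem kernel_apply_eq_map_step (P : Measure Z) [IsProbabilityMeasure P]
    (hG : Measurable (Function.uncurry G)) (θ : EuclideanSpace ℝ (Fin d)) :
    kernel G P γ θ = P.map (step G γ θ) := kernel_apply G P γ hG θ

/-- Invariance of `π` under the kernel, expressed with the step map. -/
theorem Invariant.measurePreserving_step {P : Measure Z} [IsProbabilityMeasure P]
    (hG : Measurable (Function.uncurry G)) {π : Measure (EuclideanSpace ℝ (Fin d))} [SFinite π]
    (hπ : (kernel G P γ).Invariant π) :
    MeasurePreserving (Function.uncurry (step G γ)) (π.prod P) π := by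
  refine ⟨measurable_step hG, ?_⟩
  ext s hs
  rw [Measure.map_apply (measurable_step hG) hs,
    Measure.prod_apply (measurable_step hG hs)]
  conv_rhs => rw [← hπ.def, Measure.bind_apply hs (Kernel.aemeasurable _)]
  refine lintegral_congr fun θ => ?_
  rw [kernel_apply_eq_map_step P hG, Measure.map_apply (measurable_step_right hG θ) hs]
  rfl

theorem measurePreserving_iterate {P : Measure Z} [IsProbabilityMeasure P]
    (hG : Measurable (Function.uncurry G)) {π : Measure (EuclideanSpace ℝ (Fin d))}
    [IsProbabilityMeasure π] (hπ : (kernel G P γ).Invariant π) (k : ℕ) :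
    MeasurePreserving (fun ω => iterate G γ ω k) (canonicalMeasure π P) π := by
  induction k with
  | zero =>
    unfold canonicalMeasure
    exact measurePreserving_fst
  | succ k ih =>
    have h1 := (Invariant.measurePreserving_step hG hπ).comp (ih.prod (MeasurePreserving.id P))
    refine ⟨measurable_iterate hG _, ?_⟩
    -- After resampling entry k, the pair of θ_k and the new noise has law π ⊗ P, which one step
    -- maps to π.
    rw [← (measurePreserving_resample π P k).map_eq,
      Measure.map_map (measurable_iterate hG _) (measurePreserving_resample π P k).measurable]
    refine Eq.trans ?_ h1.map_eq
    congr 1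
    ext1 q
    simp only [Function.comp, iterate_succ, Function.uncurry, Prod.map]
    rw [iterate_update q.1 q.2 le_rfl]
    simp

end Iterates

/-! ### Contraction and drift of one gradient step -/

section OneStep

variable {d : ℕ} {Z : Type*} [MeasurableSpace Z]

theorem StronglyConvex.inner_ge {f : EuclideanSpace ℝ (Fin d) → ℝ} {μ : ℝ}
    (h : StronglyConvex f μ) (θ θ' : EuclideanSpace ℝ (Fin d)) :
    μ * ‖θ - θ'‖ ^ 2 ≤ inner ℝ (gradient f θ - gradient f θ') (θ - θ') := by
  have h1 := h.lower_bound θ θ'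
  have h2 := h.lower_bound θ' θ
  rw [← neg_sub θ θ', inner_neg_right, norm_neg] at h2
  rw [inner_sub_left]
  linarith

theorem gradient_eq_zero_of_forall_le {f : EuclideanSpace ℝ (Fin d) → ℝ}
    {θs : EuclideanSpace ℝ (Fin d)} (h : ∀ θ, f θs ≤ f θ) : gradient f θs = 0 := by
  have : IsLocalMin f θs := Filter.Eventually.of_forall h
  simp [gradient, this.fderiv_eq_zero]

/-- A random map with synchronous contraction in mean square at rate `1 - x` and with a
mean-square drift towards `θs` up to the level `K`. -/
structure ContractingStep (S : EuclideanSpace ℝ (Fin d) → Z → EuclideanSpace ℝ (Fin d))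
    (P : Measure Z) (θs : EuclideanSpace ℝ (Fin d)) (x K : ℝ) : Prop where
  measurable : Measurable (Function.uncurry S)
  memLp : ∀ θ, MemLp (S θ) 2 P
  contraction : ∀ θ θ', ∫ z, ‖S θ z - S θ' z‖ ^ 2 ∂P ≤ (1 - x) * ‖θ - θ'‖ ^ 2
  drift : ∀ θ, ∫ z, ‖S θ z - θs‖ ^ 2 ∂P ≤ (1 - x) * ‖θ - θs‖ ^ 2 + x * K / 2

namespace NoiseCondition

variable {p : ℝ} {f : EuclideanSpace ℝ (Fin d) → ℝ}
  {G : EuclideanSpace ℝ (Fin d) → Z → EuclideanSpace ℝ (Fin d)} {P : Measure Z}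
  {θs : EuclideanSpace ℝ (Fin d)} {L₁ τ : ℝ}

theorem memLp_star [IsProbabilityMeasure P] (h : NoiseCondition p f G P θs L₁ τ) (hp : 2 ≤ p) :
    MemLp (G θs) 2 P := by
  have hm : Measurable (G θs) := h.measurable.comp measurable_prodMk_left
  have : MemLp (G θs) (ENNReal.ofReal p) P :=
    ⟨hm.aestronglyMeasurable, h.moment.trans_lt ENNReal.ofReal_lt_top⟩
  refine this.mono_exponent ?_
  simpa using ENNReal.ofReal_le_ofReal hp

theorem integral_star_le [IsProbabilityMeasure P] (h : NoiseCondition p f G P θs L₁ τ)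
    (hp : 2 ≤ p) : ∫ z, ‖G θs z‖ ^ 2 ∂P ≤ τ ^ 2 := by
  have hm : Measurable (G θs) := h.measurable.comp measurable_prodMk_left
  have h1 : eLpNorm (G θs) 2 P ≤ ENNReal.ofReal τ := by
    refine le_trans (eLpNorm_le_eLpNorm_of_exponent_le ?_ hm.aestronglyMeasurable) h.moment
    simpa using ENNReal.ofReal_le_ofReal hp
  rw [(h.memLp_star hp).eLpNorm_eq_integral_rpow_norm two_ne_zero ENNReal.ofNat_ne_top,
    ENNReal.ofReal_le_ofReal_iff h.τ_nonneg] at h1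
  simp only [ENNReal.toReal_ofNat, Real.rpow_two] at h1
  have h0 : 0 ≤ ∫ z, ‖G θs z‖ ^ 2 ∂P := integral_nonneg fun _ => by positivity
  calc _ = ((∫ z, ‖G θs z‖ ^ 2 ∂P) ^ (2⁻¹ : ℝ)) ^ 2 := by
        rw [← Real.rpow_natCast, ← Real.rpow_mul h0]; norm_num
    _ ≤ _ := by gcongr

theorem lintegral_sub_sq_le (h : NoiseCondition p f G P θs L₁ τ) (hp : 2 ≤ p)
    (θ θ' : EuclideanSpace ℝ (Fin d)) :
    ∫⁻ z, ENNReal.ofReal (‖G θ z - G θ' z‖ ^ 2) ∂P ≤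
      ENNReal.ofReal (L₁ * inner ℝ (gradient f θ - gradient f θ') (θ - θ')) := by
  have := h.cocoercive 2 le_rfl (by exact_mod_cast hp) θ θ'
  simp only [pow_one, Nat.add_one_sub_one, tsub_self, pow_zero, mul_one] at this
  refine le_of_eq_of_le (lintegral_congr fun z => ?_) this
  rw [ENNReal.ofReal_pow (norm_nonneg _), ofReal_norm]

theorem memLp_sub (h : NoiseCondition p f G P θs L₁ τ) (hp : 2 ≤ p)
    (θ θ' : EuclideanSpace ℝ (Fin d)) : MemLp (fun z => G θ z - G θ' z) 2 P := by
  have hm : Measurable (fun z => G θ z - G θ' z) :=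
    (h.measurable.comp measurable_prodMk_left).sub (h.measurable.comp measurable_prodMk_left)
  rw [memLp_two_iff_integrable_sq_norm hm.aestronglyMeasurable]
  refine ⟨(hm.norm.pow_const 2).aestronglyMeasurable, ?_⟩
  rw [hasFiniteIntegral_iff_ofReal (Filter.Eventually.of_forall fun _ => by positivity)]
  exact (h.lintegral_sub_sq_le hp θ θ').trans_lt ENNReal.ofReal_lt_top

theorem integral_sub_sq_le (h : NoiseCondition p f G P θs L₁ τ) (hp : 2 ≤ p)
    (θ θ' : EuclideanSpace ℝ (Fin d))
    (h0 : 0 ≤ inner ℝ (gradient f θ - gradient f θ') (θ - θ')) :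
    ∫ z, ‖G θ z - G θ' z‖ ^ 2 ∂P ≤ L₁ * inner ℝ (gradient f θ - gradient f θ') (θ - θ') := by
  rw [integral_eq_lintegral_of_nonneg_ae (Filter.Eventually.of_forall fun _ => by positivity)
    (h.memLp_sub hp θ θ').norm.integrable_sq.1]
  exact ENNReal.toReal_le_of_le_ofReal (mul_nonneg h.L₁_pos.le h0) (h.lintegral_sub_sq_le hp θ θ')

theorem memLp [IsProbabilityMeasure P] (h : NoiseCondition p f G P θs L₁ τ) (hp : 2 ≤ p)
    (θ : EuclideanSpace ℝ (Fin d)) : MemLp (G θ) 2 P := by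
  have := (h.memLp_sub hp θ θs).add (h.memLp_star hp)
  refine this.congr_norm (h.integrable θ).1 (Filter.Eventually.of_forall fun z => ?_)
  simp

theorem integral_norm_sub_smul_sq {F : Type*} [NormedAddCommGroup F] [InnerProductSpace ℝ F]
    [CompleteSpace F] [IsProbabilityMeasure P] {D : Z → F}
    (hD : MemLp D 2 P) (Δ : F) (γ : ℝ) :
    ∫ z, ‖Δ - γ • D z‖ ^ 2 ∂P =
      ‖Δ‖ ^ 2 - 2 * γ * inner ℝ (∫ z, D z ∂P) Δ + γ ^ 2 * ∫ z, ‖D z‖ ^ 2 ∂P := by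
  have hi : Integrable D P := hD.integrable (by norm_num)
  have hsq : Integrable (fun z => ‖D z‖ ^ 2) P := hD.norm.integrable_sq
  have hin : Integrable (fun z => inner ℝ Δ (D z)) P := hi.const_inner Δ
  have e : ∀ z, ‖Δ - γ • D z‖ ^ 2 =
      ‖Δ‖ ^ 2 - 2 * γ * inner ℝ Δ (D z) + γ ^ 2 * ‖D z‖ ^ 2 := by
    intro z
    rw [norm_sub_sq_real, inner_smul_right, norm_smul, mul_pow, Real.norm_eq_abs, sq_abs]
    ring
  have i1 : Integrable (fun z => ‖Δ‖ ^ 2 - 2 * γ * inner ℝ Δ (D z)) P :=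
    (integrable_const _).sub (hin.const_mul _)
  simp_rw [e]
  rw [integral_add i1 (hsq.const_mul _),
    integral_sub (integrable_const _) (hin.const_mul _), integral_const_mul, integral_const_mul,
    integral_inner hi, real_inner_comm]
  simp

/-- Expanding the square gives -2γI + γ²‖·‖², where I is the inner product of the gradient
difference with the displacement. Co-coercivity bounds the quadratic term by I, γL ≤ 1/2 absorbs it,
and strong convexity turns the remaining -γI into the rate γμ. -/
theorem contractingStep [IsProbabilityMeasure P] {μ L γ : ℝ}
    (h : NoiseCondition p f G P θs L₁ τ) (hp : 2 ≤ p)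
    (hf : StronglyConvex f μ) (hmin : ∀ θ, f θs ≤ f θ) (hL : L₁ ≤ L) (hγ : 0 < γ)
    (hγL : γ * L ≤ 1 / 2) :
    ContractingStep (step G γ) P θs (γ * μ) (4 * γ * τ ^ 2 / μ) where
  measurable := measurable_step h.measurable
  memLp θ := (memLp_const θ).sub ((h.memLp hp θ).const_smul γ)
  contraction θ θ' := by
    have h1 := hf.inner_ge θ θ'
    set I := inner ℝ (gradient f θ - gradient f θ') (θ - θ') with hI
    have hI0 : 0 ≤ I := le_trans (mul_nonneg hf.pos.le (sq_nonneg _)) h1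
    have h2 := h.integral_sub_sq_le hp θ θ' hI0
    have e : ∀ z, step G γ θ z - step G γ θ' z = (θ - θ') - γ • (G θ z - G θ' z) := by
      intro z; simp only [step]; module
    simp_rw [e]
    rw [integral_norm_sub_smul_sq (h.memLp_sub hp θ θ'),
      integral_sub (h.integrable θ) (h.integrable θ'), h.unbiased, h.unbiased, ← hI]
    rw [← hI] at h2
    have h3 : γ ^ 2 * ∫ z, ‖G θ z - G θ' z‖ ^ 2 ∂P ≤ γ ^ 2 * (L * I) := by
      gcongr; exact h2.trans (by gcongr)
    have h4 : γ * L * (γ * I) ≤ 1 / 2 * (γ * I) := by gcongr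
    have h5 : γ * (μ * ‖θ - θ'‖ ^ 2) ≤ γ * I := by gcongr
    nlinarith
  drift θ := by
    have h1 := hf.inner_ge θ θs
    set I := inner ℝ (gradient f θ - gradient f θs) (θ - θs) with hI
    have hI0 : 0 ≤ I := le_trans (mul_nonneg hf.pos.le (sq_nonneg _)) h1
    have h2 := h.integral_sub_sq_le hp θ θs hI0
    have e : ∀ z, step G γ θ z - θs = (θ - θs) - γ • G θ z := by
      intro z; simp only [step]; module
    simp_rw [e]
    rw [gradient_eq_zero_of_forall_le hmin, sub_zero] at hI
    rw [integral_norm_sub_smul_sq (h.memLp hp θ), h.unbiased, ← hI]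
    -- Comparison with the noise at the minimizer costs a factor 2; the leftover 2γ²τ² is exactly
    -- xK/2 for x = γμ and K = 4γτ²/μ.
    have h6 : ∫ z, ‖G θ z‖ ^ 2 ∂P ≤ 2 * (L₁ * I) + 2 * τ ^ 2 := by
      have i1 := (h.memLp_sub hp θ θs).norm.integrable_sq
      have i2 := (h.memLp_star hp).norm.integrable_sq
      calc ∫ z, ‖G θ z‖ ^ 2 ∂P ≤ ∫ z, (2 * ‖G θ z - G θs z‖ ^ 2 + 2 * ‖G θs z‖ ^ 2) ∂P := by
            refine integral_mono (h.memLp hp θ).norm.integrable_sq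
              ((i1.const_mul 2).add (i2.const_mul 2)) fun z => ?_
            have := norm_add_le (G θ z - G θs z) (G θs z)
            rw [sub_add_cancel] at this
            have h7 := mul_self_nonneg (‖G θ z - G θs z‖ - ‖G θs z‖)
            have h8 := pow_le_pow_left₀ (norm_nonneg _) this 2
            simp only
            nlinarith
        _ = 2 * ∫ z, ‖G θ z - G θs z‖ ^ 2 ∂P + 2 * ∫ z, ‖G θs z‖ ^ 2 ∂P := by
            rw [integral_add (i1.const_mul 2) (i2.const_mul 2), integral_const_mul,
              integral_const_mul]
        _ ≤ _ := by gcongr; exact h.integral_star_le hp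
    have h3 : γ ^ 2 * ∫ z, ‖G θ z‖ ^ 2 ∂P ≤ γ ^ 2 * (2 * (L * I) + 2 * τ ^ 2) := by
      gcongr; exact h6.trans (by gcongr)
    have h4 : γ * L * (γ * I) ≤ 1 / 2 * (γ * I) := by gcongr
    have h5 : γ * (μ * ‖θ - θs‖ ^ 2) ≤ γ * I := by gcongr
    have h9 : γ * μ * (4 * γ * τ ^ 2 / μ) / 2 = 2 * γ ^ 2 * τ ^ 2 := by
      have := hf.pos.ne'
      field_simp; ring
    rw [h9]
    nlinarith

end NoiseCondition

end OneStep

/-! ### Modulus of continuity and its contraction under the Markov operator -/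

section Modulus

variable {d : ℕ}

/-- `h` is Lipschitz with constant `2 B` for the cost
`‖θ - θ'‖ * √(‖θ - θs‖² + ‖θ' - θs‖² + 2 K)`, in the form obtained from the inequality of arithmetic
and geometric means. -/
def HasModulus (θs : EuclideanSpace ℝ (Fin d)) (K B : ℝ)
    (h : EuclideanSpace ℝ (Fin d) → EuclideanSpace ℝ (Fin d)) : Prop :=
  ∀ t : ℝ, 0 < t → ∀ θ θ', ‖h θ - h θ'‖ ≤
    B * (t * ‖θ - θ'‖ ^ 2 + (‖θ - θs‖ ^ 2 + ‖θ' - θs‖ ^ 2 + 2 * K) / t)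

namespace HasModulus

variable {θs : EuclideanSpace ℝ (Fin d)} {K B B' : ℝ}
  {h g : EuclideanSpace ℝ (Fin d) → EuclideanSpace ℝ (Fin d)}

theorem mono (hh : HasModulus θs K B h) (hB : B ≤ B') (hK : 0 ≤ K) : HasModulus θs K B' h := by
  intro t ht θ θ'
  refine (hh t ht θ θ').trans ?_
  gcongr

theorem add (hh : HasModulus θs K B h) (hg : HasModulus θs K B' g) :
    HasModulus θs K (B + B') (fun θ => h θ + g θ) := by
  intro t ht θ θ'
  rw [add_sub_add_comm, add_mul]
  exact (norm_add_le _ _).trans (add_le_add (hh t ht θ θ') (hg t ht θ θ'))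

theorem sub_const (hh : HasModulus θs K B h) (c : EuclideanSpace ℝ (Fin d)) :
    HasModulus θs K B (fun θ => h θ - c) := by
  intro t ht θ θ'
  rw [sub_sub_sub_cancel_right]
  exact hh t ht θ θ'

theorem norm_image_sub_le (hh : HasModulus θs K B h) (hB : 0 ≤ B)
    (θ θ' : EuclideanSpace ℝ (Fin d)) :
    ‖h θ - h θ'‖ ≤ B * (3 * ‖θ - θs‖ ^ 2 + 3 * ‖θ' - θs‖ ^ 2 + 2 * K) := by
  refine (hh 1 one_pos θ θ').trans (mul_le_mul_of_nonneg_left ?_ hB)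
  have h1 := norm_sub_le (θ - θs) (θ' - θs)
  rw [sub_sub_sub_cancel_right] at h1
  have h2 := pow_le_pow_left₀ (norm_nonneg _) h1 2
  nlinarith [mul_self_nonneg (‖θ - θs‖ - ‖θ' - θs‖)]

theorem continuous (hh : HasModulus θs K B h) : Continuous h := by
  rw [continuous_iff_continuousAt]
  intro θ₀
  rw [ContinuousAt, tendsto_iff_norm_sub_tendsto_zero]
  have hbd : ∀ θ, ‖h θ - h θ₀‖ ≤
      B * (‖θ - θ₀‖ + (‖θ - θs‖ ^ 2 + ‖θ₀ - θs‖ ^ 2 + 2 * K) * ‖θ - θ₀‖) := by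
    intro θ
    rcases eq_or_ne θ θ₀ with rfl | hne
    · simp
    · have hpos : 0 < ‖θ - θ₀‖ := norm_pos_iff.2 (sub_ne_zero.2 hne)
      -- The choice t = 1/‖θ - θ₀‖ makes both terms of the modulus linear in the distance.
      have := hh (‖θ - θ₀‖)⁻¹ (by positivity) θ θ₀
      rwa [div_inv_eq_mul, pow_two ‖θ - θ₀‖, inv_mul_cancel_left₀ hpos.ne'] at this
  refine squeeze_zero (fun _ => norm_nonneg _) hbd ?_
  have : Continuous fun θ => B * (‖θ - θ₀‖ + (‖θ - θs‖ ^ 2 + ‖θ₀ - θs‖ ^ 2 + 2 * K) * ‖θ - θ₀‖) := by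
    fun_prop
  simpa using this.tendsto θ₀

theorem integrable_comp {α : Type*} [MeasurableSpace α] {ρ : Measure α} [IsFiniteMeasure ρ]
    (hh : HasModulus θs K B h) (hB : 0 ≤ B) {T : α → EuclideanSpace ℝ (Fin d)}
    (hT : MemLp T 2 ρ) : Integrable (fun a => h (T a)) ρ := by
  have i1 : Integrable (fun a => ‖T a - θs‖ ^ 2) ρ :=
    (hT.sub (memLp_const θs)).norm.integrable_sq
  have i2 : Integrable (fun a => ‖h θs‖ +
      B * (3 * ‖T a - θs‖ ^ 2 + 3 * ‖θs - θs‖ ^ 2 + 2 * K)) ρ :=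
    (integrable_const _).add
      ((((i1.const_mul 3).add (integrable_const _)).add (integrable_const _)).const_mul B)
  refine i2.mono' (hh.continuous.comp_aestronglyMeasurable hT.1)
    (Filter.Eventually.of_forall fun a => ?_)
  have h1 := hh.norm_image_sub_le hB (T a) θs
  have h2 := norm_le_norm_add_norm_sub' (h (T a)) (h θs)
  linarith

/-- A centred function is its own difference averaged over π, so the modulus at t = 1 bounds its
size. The 7 comes from 3m + 2K ≤ 7m. -/
theorem norm_le_of_integral_eq_zero (hh : HasModulus θs K B h) (hB : 0 ≤ B)
    {π : Measure (EuclideanSpace ℝ (Fin d))} [IsProbabilityMeasure π] (hπ : MemLp id 2 π)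
    (h0 : ∫ θ, h θ ∂π = 0) {m : ℝ} (hm : ∫ θ, ‖θ - θs‖ ^ 2 ∂π ≤ m) (hKm : K ≤ 2 * m)
    (θ : EuclideanSpace ℝ (Fin d)) : ‖h θ‖ ≤ 7 * B * (‖θ - θs‖ ^ 2 + m) := by
  have i1 : Integrable (fun a => ‖a - θs‖ ^ 2) π := (hπ.sub (memLp_const θs)).norm.integrable_sq
  have ih : Integrable h π := hh.integrable_comp hB hπ
  have i2 : Integrable (fun θ' => 3 * ‖θ - θs‖ ^ 2 + 3 * ‖θ' - θs‖ ^ 2) π :=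
    (integrable_const _).add (i1.const_mul 3)
  have i3 : Integrable (fun θ' => 3 * ‖θ - θs‖ ^ 2 + 3 * ‖θ' - θs‖ ^ 2 + 2 * K) π :=
    i2.add (integrable_const _)
  have e : h θ = ∫ θ', (h θ - h θ') ∂π := by
    rw [integral_sub (integrable_const _) ih, h0]; simp
  have h1 : ‖h θ‖ ≤ B * (3 * ‖θ - θs‖ ^ 2 + 3 * ∫ θ', ‖θ' - θs‖ ^ 2 ∂π + 2 * K) := by
    rw [e]
    refine (norm_integral_le_of_norm_le (i3.const_mul B)
      (Filter.Eventually.of_forall fun θ' => hh.norm_image_sub_le hB θ θ')).trans (le_of_eq ?_)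
    rw [integral_const_mul, integral_add i2 (integrable_const _),
      integral_add (integrable_const _) (i1.const_mul 3),
      show ∫ θ', 3 * ‖θ' - θs‖ ^ 2 ∂π = 3 * ∫ θ', ‖θ' - θs‖ ^ 2 ∂π from integral_const_mul _ _]
    simp
  have h2 : 3 * ‖θ - θs‖ ^ 2 + 3 * ∫ θ', ‖θ' - θs‖ ^ 2 ∂π + 2 * K ≤ 7 * (‖θ - θs‖ ^ 2 + m) := by
    nlinarith [sq_nonneg ‖θ - θs‖]
  calc _ ≤ _ := h1
    _ ≤ B * (7 * (‖θ - θs‖ ^ 2 + m)) := by gcongr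
    _ = _ := by ring

end HasModulus

variable {Z : Type*} [MeasurableSpace Z]

/-- The Markov operator of a random map. -/
noncomputable def markovOp (S : EuclideanSpace ℝ (Fin d) → Z → EuclideanSpace ℝ (Fin d))
    (P : Measure Z) (h : EuclideanSpace ℝ (Fin d) → EuclideanSpace ℝ (Fin d))
    (θ : EuclideanSpace ℝ (Fin d)) : EuclideanSpace ℝ (Fin d) := ∫ z, h (S θ z) ∂P

/-- The partial sums `∑_{j < N} Q ^ j h` of the solution of the Poisson equation for `h`. -/
noncomputable def poissonSum (S : EuclideanSpace ℝ (Fin d) → Z → EuclideanSpace ℝ (Fin d))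
    (P : Measure Z) (h : EuclideanSpace ℝ (Fin d) → EuclideanSpace ℝ (Fin d)) :
    ℕ → EuclideanSpace ℝ (Fin d) → EuclideanSpace ℝ (Fin d)
  | 0 => fun _ => 0
  | N + 1 => fun θ => h θ + markovOp S P (poissonSum S P h N) θ

namespace ContractingStep

variable {θs : EuclideanSpace ℝ (Fin d)} {x K B : ℝ}
  {S : EuclideanSpace ℝ (Fin d) → Z → EuclideanSpace ℝ (Fin d)} {P : Measure Z}
  [IsProbabilityMeasure P] {h : EuclideanSpace ℝ (Fin d) → EuclideanSpace ℝ (Fin d)}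

/-- Under the synchronous coupling ‖θ - θ'‖² shrinks by 1 - x, while the weight W grows by at most 1
+ x/2. Rescaling t by q = 1 - 3x/4 balances the two: both (1 - x)/q and (1 + x/2)q are at most 1 -
x/4. The free parameter t avoids any Cauchy–Schwarz step under the integral. -/
theorem hasModulus_markovOp (hS : ContractingStep S P θs x K) (hx : 0 ≤ x) (hx1 : x ≤ 1)
    (hB : 0 ≤ B) (hK : 0 ≤ K) (hh : HasModulus θs K B h) :
    HasModulus θs K (B * (1 - x / 4)) (markovOp S P h) := by
  intro t ht θ θ'
  set q := 1 - 3 * x / 4 with hq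
  have hq0 : 0 < q := by linarith
  have ht' : 0 < t / q := by positivity
  have i1 : Integrable (fun z => ‖S θ z - S θ' z‖ ^ 2) P :=
    ((hS.memLp θ).sub (hS.memLp θ')).norm.integrable_sq
  have i2 : ∀ θ, Integrable (fun z => ‖S θ z - θs‖ ^ 2) P := fun θ =>
    ((hS.memLp θ).sub (memLp_const θs)).norm.integrable_sq
  have i3 : Integrable (fun z => ‖S θ z - θs‖ ^ 2 + ‖S θ' z - θs‖ ^ 2) P := (i2 θ).add (i2 θ')
  have i4 : Integrable (fun z => ‖S θ z - θs‖ ^ 2 + ‖S θ' z - θs‖ ^ 2 + 2 * K) P :=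
    i3.add (integrable_const _)
  have h1 : ‖markovOp S P h θ - markovOp S P h θ'‖ ≤
      B * (t / q * ∫ z, ‖S θ z - S θ' z‖ ^ 2 ∂P +
        (∫ z, ‖S θ z - θs‖ ^ 2 ∂P + ∫ z, ‖S θ' z - θs‖ ^ 2 ∂P + 2 * K) / (t / q)) := by
    rw [markovOp, markovOp, ← integral_sub (hh.integrable_comp hB (hS.memLp θ))
      (hh.integrable_comp hB (hS.memLp θ'))]
    refine (norm_integral_le_of_norm_le
      (((i1.const_mul (t / q)).add (i4.div_const (t / q))).const_mul B)
      (Filter.Eventually.of_forall fun z => hh (t / q) ht' (S θ z) (S θ' z))).trans (le_of_eq ?_)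
    rw [integral_const_mul]
    simp only [Pi.add_apply]
    rw [integral_add (i1.const_mul (t / q)) (i4.div_const (t / q)),
      integral_const_mul, integral_div, integral_add i3 (integrable_const _),
      integral_add (i2 θ) (i2 θ')]
    simp
  refine h1.trans ?_
  rw [mul_assoc]
  gcongr
  have hc := hS.contraction θ θ'
  have hd := hS.drift θ
  have hd' := hS.drift θ'
  set W := ‖θ - θs‖ ^ 2 + ‖θ' - θs‖ ^ 2 + 2 * K with hW
  have hW0 : 0 ≤ W := by positivity
  have h2 : ∫ z, ‖S θ z - θs‖ ^ 2 ∂P + ∫ z, ‖S θ' z - θs‖ ^ 2 ∂P + 2 * K ≤ (1 + x / 2) * W := by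
    have := mul_nonneg hx (add_nonneg (sq_nonneg ‖θ - θs‖) (sq_nonneg ‖θ' - θs‖))
    rw [hW]; nlinarith
  have h3 : t / q * ∫ z, ‖S θ z - S θ' z‖ ^ 2 ∂P ≤ (1 - x / 4) * (t * ‖θ - θ'‖ ^ 2) := by
    calc _ ≤ t / q * ((1 - x) * ‖θ - θ'‖ ^ 2) := by gcongr
      _ = (1 - x) / q * (t * ‖θ - θ'‖ ^ 2) := by ring
      _ ≤ _ := by
        gcongr
        rw [div_le_iff₀ hq0, hq]
        nlinarith [sq_nonneg x]
  have h4 : (∫ z, ‖S θ z - θs‖ ^ 2 ∂P + ∫ z, ‖S θ' z - θs‖ ^ 2 ∂P + 2 * K) / (t / q) ≤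
      (1 - x / 4) * (W / t) := by
    calc _ ≤ (1 + x / 2) * W / (t / q) := by gcongr
      _ = (1 + x / 2) * q * (W / t) := by field_simp
      _ ≤ _ := by
        gcongr
        rw [hq]
        nlinarith [sq_nonneg x]
  rw [mul_add]
  exact add_le_add h3 h4

/-- 4B/x is the fixed point of c ↦ B + c(1 - x/4), hence a bound uniform in N. -/
theorem hasModulus_poissonSum (hS : ContractingStep S P θs x K) (hx : 0 < x) (hx1 : x ≤ 1)
    (hB : 0 ≤ B) (hK : 0 ≤ K) (hh : HasModulus θs K B h) (N : ℕ) :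
    HasModulus θs K (4 * B / x) (poissonSum S P h N) := by
  induction N with
  | zero =>
    intro t ht θ θ'
    simp only [poissonSum, sub_self, norm_zero]
    positivity
  | succ N ih =>
    have := hh.add (hS.hasModulus_markovOp hx.le hx1 (by positivity) hK ih)
    refine this.mono (le_of_eq ?_) hK
    field_simp; ring

/-- By invariance Q preserves π-means, so every Q^j h stays centred. -/
theorem integral_poissonSum (hS : ContractingStep S P θs x K) (hx : 0 < x) (hx1 : x ≤ 1)
    (hB : 0 ≤ B) (hK : 0 ≤ K) (hh : HasModulus θs K B h)
    {π : Measure (EuclideanSpace ℝ (Fin d))} [IsProbabilityMeasure π] (hπ : MemLp id 2 π)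
    (hinv : MeasurePreserving (Function.uncurry S) (π.prod P) π) (h0 : ∫ θ, h θ ∂π = 0) (N : ℕ) :
    ∫ θ, poissonSum S P h N θ ∂π = 0 := by
  induction N with
  | zero => simp [poissonSum]
  | succ N ih =>
    have hm := hS.hasModulus_poissonSum hx hx1 hB hK hh N
    have hi : Integrable (poissonSum S P h N) π := hm.integrable_comp (by positivity) hπ
    have hi' : Integrable (fun q : EuclideanSpace ℝ (Fin d) × Z => poissonSum S P h N (S q.1 q.2))
        (π.prod P) := hinv.integrable_comp_of_integrable hi
    have e : ∫ θ, markovOp S P (poissonSum S P h N) θ ∂π = 0 := by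
      rw [← ih]
      conv_rhs => rw [← hinv.map_eq,
        integral_map hinv.measurable.aemeasurable hm.continuous.aestronglyMeasurable]
      exact (integral_prod _ hi').symm
    have ih_h : Integrable h π := hh.integrable_comp hB hπ
    simp only [poissonSum]
    rw [integral_add ih_h, h0, e, add_zero]
    exact hi'.integral_prod_left

end ContractingStep

end Modulus

/-! ### The potential argument for moments of partial sums -/

theorem rpow_sub_one_mul_le {u w p : ℝ} (hu : 0 ≤ u) (hw : 0 ≤ w) (hp : 2 ≤ p) :
    u ^ (p - 1) * w ≤ u ^ p + w ^ p := by
  have key : ∀ m : ℝ, 0 ≤ m → m ^ (p - 1) * m = m ^ p := by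
    intro m hm
    conv_rhs => rw [show p = p - 1 + 1 by ring, Real.rpow_add_of_nonneg hm (by linarith)
      zero_le_one, Real.rpow_one]
  rcases le_total u w with h | h
  · calc u ^ (p - 1) * w ≤ w ^ (p - 1) * w := by
          gcongr
          linarith
      _ = w ^ p := key w hw
      _ ≤ _ := by linarith [Real.rpow_nonneg hu p]
  · calc u ^ (p - 1) * w ≤ u ^ (p - 1) * u := by gcongr
      _ = u ^ p := key u hu
      _ ≤ _ := by linarith [Real.rpow_nonneg hw p]

theorem _root_.MeasureTheory.MemLp.integrable_norm_rpow_ofReal {α F : Type*} [MeasurableSpace α]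
    {ρ : Measure α} [NormedAddCommGroup F] {X : α → F} {p : ℝ} (hp : 2 ≤ p)
    (hX : MemLp X (ENNReal.ofReal p) ρ) : Integrable (fun a => ‖X a‖ ^ p) ρ := by
  have := hX.integrable_norm_rpow (by simp; linarith) ENNReal.ofReal_ne_top
  rwa [ENNReal.toReal_ofReal (by linarith)] at this

theorem measurable_normPowGrad {d : ℕ} {p : ℝ} :
    Measurable (normPowGrad p : EuclideanSpace ℝ (Fin d) → _) := by
  unfold normPowGrad
  fun_prop

section Rio

variable {d : ℕ} {Z : Type*} {G : EuclideanSpace ℝ (Fin d) → Z → EuclideanSpace ℝ (Fin d)} {γ : ℝ}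
  {h : EuclideanSpace ℝ (Fin d) → EuclideanSpace ℝ (Fin d)}

/-- The partial sum `∑_{k < n} h(θ_k)`. -/
noncomputable def partialSum (G : EuclideanSpace ℝ (Fin d) → Z → EuclideanSpace ℝ (Fin d)) (γ : ℝ)
    (h : EuclideanSpace ℝ (Fin d) → EuclideanSpace ℝ (Fin d)) (n : ℕ)
    (ω : EuclideanSpace ℝ (Fin d) × (ℕ → Z)) : EuclideanSpace ℝ (Fin d) :=
  ∑ k ∈ Finset.range n, h (iterate G γ ω k)

theorem partialSum_update (n : ℕ) (ω : EuclideanSpace ℝ (Fin d) × (ℕ → Z)) (z : Z) :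
    partialSum G γ h (n + 1) (ω.1, Function.update ω.2 n z) = partialSum G γ h (n + 1) ω := by
  refine Finset.sum_congr rfl fun k hk => ?_
  rw [iterate_update ω z (Nat.lt_succ_iff.1 (Finset.mem_range.1 hk))]

variable [MeasurableSpace Z] {P : Measure Z}

/-- A step map with its stationary law and an envelope `v`, in `L^p`, for a function `h` and, up to
the factor `4 / x`, for the partial sums of its Poisson solution. -/
structure PoissonEnvelope (G : EuclideanSpace ℝ (Fin d) → Z → EuclideanSpace ℝ (Fin d)) (γ : ℝ)
    (P : Measure Z) (π : Measure (EuclideanSpace ℝ (Fin d)))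
    (h : EuclideanSpace ℝ (Fin d) → EuclideanSpace ℝ (Fin d))
    (v : EuclideanSpace ℝ (Fin d) → ℝ) (p x v₀ : ℝ) : Prop where
  measurable_G : Measurable (Function.uncurry G)
  measurePreserving_iterate : ∀ [IsProbabilityMeasure P] k,
    MeasurePreserving (fun ω => iterate G γ ω k) (canonicalMeasure π P) π
  measurable_h : Measurable h
  measurable_poisson : ∀ N, Measurable (poissonSum (step G γ) P h N)
  integrable_poisson : ∀ N θ, Integrable (fun z => poissonSum (step G γ) P h N (step G γ θ z)) P
  norm_h_le : ∀ θ, ‖h θ‖ ≤ v θ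
  norm_poisson_le : ∀ N θ, ‖poissonSum (step G γ) P h N θ‖ ≤ 4 / x * v θ
  memLp_v : MemLp v (ENNReal.ofReal p) π
  integral_v_le : ∫ θ, v θ ^ p ∂π ≤ v₀ ^ p

namespace PoissonEnvelope

variable {π : Measure (EuclideanSpace ℝ (Fin d))} {v : EuclideanSpace ℝ (Fin d) → ℝ} {p x v₀ : ℝ}

theorem v_nonneg (H : PoissonEnvelope G γ P π h v p x v₀) (θ : EuclideanSpace ℝ (Fin d)) :
    0 ≤ v θ := (norm_nonneg _).trans (H.norm_h_le θ)

theorem measurable_partialSum (H : PoissonEnvelope G γ P π h v p x v₀) (n : ℕ) :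
    Measurable (partialSum G γ h n) :=
  Finset.measurable_fun_sum _ fun k _ => H.measurable_h.comp (measurable_iterate H.measurable_G k)

variable [IsProbabilityMeasure P]

theorem memLp_v_iterate (H : PoissonEnvelope G γ P π h v p x v₀) (k : ℕ) :
    MemLp (fun ω => v (iterate G γ ω k)) (ENNReal.ofReal p) (canonicalMeasure π P) :=
  H.memLp_v.comp_measurePreserving (H.measurePreserving_iterate k)

theorem integral_v_iterate_le (H : PoissonEnvelope G γ P π h v p x v₀) (k : ℕ) :
    ∫ ω, v (iterate G γ ω k) ^ p ∂(canonicalMeasure π P) ≤ v₀ ^ p := by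
  refine le_of_eq_of_le ?_ H.integral_v_le
  conv_rhs => rw [← (H.measurePreserving_iterate k).map_eq]
  rw [integral_map (H.measurePreserving_iterate k).measurable.aemeasurable]
  rw [(H.measurePreserving_iterate k).map_eq]
  exact (H.memLp_v.1.aemeasurable.pow_const p).aestronglyMeasurable

theorem memLp_partialSum (H : PoissonEnvelope G γ P π h v p x v₀) (n : ℕ) :
    MemLp (partialSum G γ h n) (ENNReal.ofReal p) (canonicalMeasure π P) := by
  refine memLp_finsetSum _ fun k _ => (H.memLp_v_iterate k).mono
    (H.measurable_h.comp (measurable_iterate H.measurable_G k)).aestronglyMeasurable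
    (Filter.Eventually.of_forall fun ω => ?_)
  rw [Real.norm_of_nonneg (H.v_nonneg _)]
  exact H.norm_h_le _

theorem integrable_inner (H : PoissonEnvelope G γ P π h v p x v₀) (hp : 2 ≤ p) (n k N : ℕ) :
    Integrable (fun ω => (inner ℝ (normPowGrad p (partialSum G γ h n ω))
      (poissonSum (step G γ) P h N (iterate G γ ω k)) : ℝ)) (canonicalMeasure π P) := by
  have i1 := (H.memLp_partialSum n).integrable_norm_rpow_ofReal hp
  have i2 := ((H.memLp_v_iterate k).const_mul (4 / x)).integrable_norm_rpow_ofReal hp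
  refine ((i1.add i2).const_mul p).mono'
    ((measurable_normPowGrad.comp (H.measurable_partialSum n)).inner
      ((H.measurable_poisson N).comp (measurable_iterate H.measurable_G k))).aestronglyMeasurable
    (Filter.Eventually.of_forall fun ω => ?_)
  have h1 := norm_inner_le_norm (𝕜 := ℝ) (normPowGrad p (partialSum G γ h n ω))
      (poissonSum (step G γ) P h N (iterate G γ ω k))
  rw [norm_normPowGrad hp, mul_assoc] at h1
  refine h1.trans (mul_le_mul_of_nonneg_left ?_ (by linarith))
  refine le_trans ?_ (rpow_sub_one_mul_le (norm_nonneg _) (norm_nonneg _) hp)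
  gcongr
  exact (H.norm_poisson_le N _).trans (le_abs_self _)

/-- The error term of the second-order expansion of the `p`-th moment at time `k`. -/
noncomputable def remainder (_ : PoissonEnvelope G γ P π h v p x v₀) (k : ℕ) : ℝ :=
  6 * p ^ 2 / x * ∫ ω, (‖partialSum G γ h k ω‖ + v (iterate G γ ω k)) ^ (p - 2) *
    v (iterate G γ ω k) ^ 2 ∂(canonicalMeasure π P)

theorem integrable_remainder (H : PoissonEnvelope G γ P π h v p x v₀) (hp : 2 ≤ p) (k : ℕ) :
    Integrable (fun ω => (‖partialSum G γ h k ω‖ + v (iterate G γ ω k)) ^ (p - 2) *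
      v (iterate G γ ω k) ^ 2) (canonicalMeasure π P) := by
  have m1 := (H.memLp_partialSum k).norm
  have m2 := H.memLp_v_iterate k
  have i1 := (m1.add m2).integrable_norm_rpow_ofReal hp
  have i2 := m2.integrable_norm_rpow_ofReal hp
  refine (i1.add i2).mono' ?_ (Filter.Eventually.of_forall fun ω => ?_)
  · exact (((m1.1.aemeasurable.add m2.1.aemeasurable).pow_const _).mul
      (m2.1.aemeasurable.pow_const 2)).aestronglyMeasurable
  · have hv := H.v_nonneg (iterate G γ ω k)
    rw [Real.norm_of_nonneg (by positivity)]
    simp only [Pi.add_apply]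
    rw [Real.norm_of_nonneg (by positivity), Real.norm_of_nonneg hv]
    exact rpow_sub_two_mul_sq_le (by positivity) hv hp

/-- Scaling v by T/v₀ before Young's inequality puts both terms at size T^p and extracts the small
factor (v₀/T)². The integrals contribute 3 + 1 + 1 = 5 copies of T^p, whence 30 = 6 · 5. -/
theorem remainder_le (H : PoissonEnvelope G γ P π h v p x v₀) (hp : 2 ≤ p) (hx : 0 < x)
    (hv₀ : 0 < v₀) {T : ℝ} (hT : (1 + p) * v₀ ≤ T) {k : ℕ}
    (hk : ∫ ω, ‖partialSum G γ h k ω‖ ^ p ∂(canonicalMeasure π P) ≤ T ^ p) :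
    H.remainder k ≤ 30 * p ^ 2 / x * (v₀ / T) ^ 2 * T ^ p := by
  have hT0 : 0 < T := lt_of_lt_of_le (by positivity) hT
  have i1 := (H.memLp_partialSum k).integrable_norm_rpow_ofReal hp
  have i2 := (H.memLp_v_iterate k).integrable_norm_rpow_ofReal hp
  simp only [Real.norm_of_nonneg (H.v_nonneg _)] at i2
  have i3 := (i1.const_mul 3).add (i2.const_mul ((1 + p) ^ p + (T / v₀) ^ p))
  have h1 : ∫ ω, (‖partialSum G γ h k ω‖ + v (iterate G γ ω k)) ^ (p - 2) *
      v (iterate G γ ω k) ^ 2 ∂(canonicalMeasure π P) ≤ (v₀ / T) ^ 2 * (5 * T ^ p) := by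
    calc _ ≤ ∫ ω, (v₀ / T) ^ 2 * (3 * ‖partialSum G γ h k ω‖ ^ p +
          ((1 + p) ^ p + (T / v₀) ^ p) * v (iterate G γ ω k) ^ p) ∂(canonicalMeasure π P) := by
          refine integral_mono (H.integrable_remainder hp k) (i3.const_mul _) fun ω => ?_
          have hv := H.v_nonneg (iterate G γ ω k)
          set w := v (iterate G γ ω k)
          set s := ‖partialSum G γ h k ω‖ with hs
          have hs0 : 0 ≤ s := norm_nonneg _
          have a1 := rpow_sub_two_mul_sq_le (add_nonneg hs0 hv)
            (show 0 ≤ T / v₀ * w by positivity) hp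
          have a2 := add_rpow_le hs0 hv (show 1 ≤ p by linarith)
          rw [Real.mul_rpow (by positivity) hv] at a1 a2
          calc (s + w) ^ (p - 2) * w ^ 2
              = (v₀ / T) ^ 2 * ((s + w) ^ (p - 2) * (T / v₀ * w) ^ 2) := by field_simp
            _ ≤ (v₀ / T) ^ 2 * (3 * s ^ p + ((1 + p) ^ p + (T / v₀) ^ p) * w ^ p) := by
              gcongr
              linarith
      _ = (v₀ / T) ^ 2 * (3 * ∫ ω, ‖partialSum G γ h k ω‖ ^ p ∂(canonicalMeasure π P) +
          ((1 + p) ^ p + (T / v₀) ^ p) *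
            ∫ ω, v (iterate G γ ω k) ^ p ∂(canonicalMeasure π P)) := by
          rw [integral_const_mul, integral_add (i1.const_mul _) (i2.const_mul _),
            integral_const_mul, integral_const_mul]
      _ ≤ (v₀ / T) ^ 2 * (3 * T ^ p + ((1 + p) ^ p + (T / v₀) ^ p) * v₀ ^ p) := by
          gcongr
          exact H.integral_v_iterate_le k
      _ ≤ _ := by
          gcongr
          rw [add_mul, ← Real.mul_rpow (by positivity) hv₀.le,
            ← Real.mul_rpow (by positivity) hv₀.le, div_mul_cancel₀ _ hv₀.ne']
          have : ((1 + p) * v₀) ^ p ≤ T ^ p := by gcongr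
          linarith
  calc H.remainder k ≤ 6 * p ^ 2 / x * ((v₀ / T) ^ 2 * (5 * T ^ p)) := by
        unfold remainder; gcongr
    _ = _ := by ring

variable [IsProbabilityMeasure π]

/-- Averaging over the last noise variable replaces a function by its image under the Markov
operator. -/
theorem integral_inner_succ (H : PoissonEnvelope G γ P π h v p x v₀) (hp : 2 ≤ p) (k N : ℕ) :
    ∫ ω, (inner ℝ (normPowGrad p (partialSum G γ h (k + 1) ω))
      (poissonSum (step G γ) P h N (iterate G γ ω (k + 1))) : ℝ) ∂(canonicalMeasure π P) =
    ∫ ω, (inner ℝ (normPowGrad p (partialSum G γ h (k + 1) ω))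
      (markovOp (step G γ) P (poissonSum (step G γ) P h N) (iterate G γ ω k)) : ℝ)
        ∂(canonicalMeasure π P) := by
  have hR := measurePreserving_resample π P k
  have hi := H.integrable_inner hp (k + 1) (k + 1) N
  conv_lhs => rw [← hR.map_eq]
  rw [integral_map hR.measurable.aemeasurable (by rw [hR.map_eq]; exact hi.1),
    integral_prod _ (by exact hR.integrable_comp_of_integrable hi)]
  refine integral_congr_ae (Filter.Eventually.of_forall fun ω => ?_)
  simp only [partialSum_update, iterate_succ, iterate_update ω _ le_rfl, Function.update_self]
  exact integral_inner (H.integrable_poisson N _) _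

/-- Fresh noise replaces g_N(θ_{k+1}) by Q g_N(θ_k); since h + Q g_N = g_{N+1}, the first-order
terms recombine into the potential at (k, N+1). -/
theorem potential_succ_le (H : PoissonEnvelope G γ P π h v p x v₀) (hp : 2 ≤ p) (hx : 0 < x)
    (hx1 : x ≤ 1) (k N : ℕ) :
    ∫ ω, (‖partialSum G γ h (k + 1) ω‖ ^ p + inner ℝ (normPowGrad p (partialSum G γ h (k + 1) ω))
      (poissonSum (step G γ) P h N (iterate G γ ω (k + 1)))) ∂(canonicalMeasure π P) ≤
    ∫ ω, (‖partialSum G γ h k ω‖ ^ p + inner ℝ (normPowGrad p (partialSum G γ h k ω))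
      (poissonSum (step G γ) P h (N + 1) (iterate G γ ω k))) ∂(canonicalMeasure π P) +
      H.remainder k := by
  have i1 := (H.memLp_partialSum (k + 1)).integrable_norm_rpow_ofReal hp
  have i2 := (H.memLp_partialSum k).integrable_norm_rpow_ofReal hp
  have i3 := H.integrable_inner hp (k + 1) (k + 1) N
  have i4 := H.integrable_inner hp k k (N + 1)
  have i5 := H.integrable_remainder hp k
  -- The first Poisson sum is h itself, so Q g_N is a difference of two Poisson sums and inherits
  -- their integrability.
  have hU : ∀ θ, markovOp (step G γ) P (poissonSum (step G γ) P h N) θ =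
      poissonSum (step G γ) P h (N + 1) θ - poissonSum (step G γ) P h 1 θ := by
    intro θ; simp [poissonSum, markovOp]
  have i6 : Integrable (fun ω => (inner ℝ (normPowGrad p (partialSum G γ h (k + 1) ω))
      (markovOp (step G γ) P (poissonSum (step G γ) P h N) (iterate G γ ω k)) : ℝ))
        (canonicalMeasure π P) := by
    simp_rw [hU, inner_sub_right]
    exact (H.integrable_inner hp (k + 1) k (N + 1)).sub (H.integrable_inner hp (k + 1) k 1)
  have i7 : Integrable (fun ω => ‖partialSum G γ h k ω‖ ^ p +
      inner ℝ (normPowGrad p (partialSum G γ h k ω))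
        (poissonSum (step G γ) P h (N + 1) (iterate G γ ω k))) (canonicalMeasure π P) := i2.add i4
  rw [integral_add i1 i3, H.integral_inner_succ hp, ← integral_add i1 i6, remainder,
    ← integral_const_mul, ← integral_add i7 (i5.const_mul _)]
  refine integral_mono (i1.add i6) (i7.add (i5.const_mul _)) fun ω => ?_
  set θ := iterate G γ ω k
  set s := partialSum G γ h k ω
  set u := markovOp (step G γ) P (poissonSum (step G γ) P h N) θ
  have hs : partialSum G γ h (k + 1) ω = s + h θ := Finset.sum_range_succ _ _
  have hg : poissonSum (step G γ) P h (N + 1) θ = h θ + u := rfl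
  simp only
  rw [hs, hg]
  refine (norm_add_rpow_add_inner_le hp s (h θ) u).trans ?_
  have hv := H.v_nonneg θ
  have h1 := H.norm_h_le θ
  have h2 := H.norm_poisson_le (N + 1) θ
  rw [hg] at h2
  have h3 : ‖u‖ ≤ ‖h θ + u‖ + ‖h θ‖ := by
    have := norm_sub_le (h θ + u) (h θ)
    rwa [add_sub_cancel_left] at this
  -- As u = g_{N+1} - h, the sum is at most 4v/x + 2v, and x ≤ 1 gives 6v/x.
  have h4 : ‖h θ‖ + ‖u‖ ≤ 6 / x * v θ := by
    have : 1 * v θ ≤ 1 / x * v θ := by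
      gcongr
      rwa [le_div_iff₀ hx, one_mul]
    have e : 6 / x * v θ = 4 / x * v θ + 2 * (1 / x * v θ) := by ring
    linarith
  have h5 : p ^ 2 * (‖s‖ + ‖h θ‖) ^ (p - 2) * ‖h θ‖ * (‖h θ‖ + ‖u‖) ≤
      p ^ 2 * (‖s‖ + v θ) ^ (p - 2) * v θ * (6 / x * v θ) := by
    gcongr
  have e : p ^ 2 * (‖s‖ + v θ) ^ (p - 2) * v θ * (6 / x * v θ) =
      6 * p ^ 2 / x * ((‖s‖ + v θ) ^ (p - 2) * v θ ^ 2) := by ring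
  linarith

/-- Iterating the one-step bound trades k for N down to k = 0, where the partial sum and its
gradient vanish. -/
theorem potential_le (H : PoissonEnvelope G γ P π h v p x v₀) (hp : 2 ≤ p) (hx : 0 < x)
    (hx1 : x ≤ 1) (k N : ℕ) :
    ∫ ω, (‖partialSum G γ h k ω‖ ^ p + inner ℝ (normPowGrad p (partialSum G γ h k ω))
      (poissonSum (step G γ) P h N (iterate G γ ω k))) ∂(canonicalMeasure π P) ≤
    ∑ j ∈ Finset.range k, H.remainder j := by
  induction k generalizing N with
  | zero =>
    simp [partialSum, normPowGrad, Real.zero_rpow (show p ≠ 0 by linarith)]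
  | succ k ih =>
    rw [Finset.sum_range_succ]
    exact (H.potential_succ_le hp hx hx1 k N).trans (by gcongr; exact ih (N + 1))

theorem integral_partialSum_le_sum (H : PoissonEnvelope G γ P π h v p x v₀) (hp : 2 ≤ p)
    (hx : 0 < x) (hx1 : x ≤ 1) (n : ℕ) :
    ∫ ω, ‖partialSum G γ h n ω‖ ^ p ∂(canonicalMeasure π P) ≤
      ∑ j ∈ Finset.range n, H.remainder j := by
  -- At N = 0 the Poisson correction is zero, leaving the plain moment.
  simpa [poissonSum] using H.potential_le hp hx hx1 n 0

/-- The constant 6 makes the induction close: T² = 36p²(n/x)v₀², so n remainders of size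
30(p²/x)(v₀/T)²T^p add up to (5/6)T^p. -/
theorem integral_partialSum_le (H : PoissonEnvelope G γ P π h v p x v₀) (hp : 2 ≤ p)
    (hx : 0 < x) (hx1 : x ≤ 1) (hv₀ : 0 < v₀) (n : ℕ) :
    ∫ ω, ‖partialSum G γ h n ω‖ ^ p ∂(canonicalMeasure π P) ≤
      (6 * p * Real.sqrt (n / x) * v₀) ^ p := by
  induction n using Nat.strong_induction_on with
  | _ n ih =>
  rcases Nat.eq_zero_or_pos n with rfl | hn
  · simp [partialSum, Real.zero_rpow (show p ≠ 0 by linarith)]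
  set T := 6 * p * Real.sqrt (n / x) * v₀ with hTdef
  have hn1 : (1 : ℝ) ≤ n := by exact_mod_cast hn
  have hsq1 : 1 ≤ Real.sqrt (n / x) := by
    rw [Real.one_le_sqrt, le_div_iff₀ hx]; linarith
  have hT : (1 + p) * v₀ ≤ T := by
    rw [hTdef]; gcongr; nlinarith
  have hT0 : 0 < T := lt_of_lt_of_le (by positivity) hT
  have hT2 : T ^ 2 = 36 * p ^ 2 * (n / x) * v₀ ^ 2 := by
    rw [hTdef, mul_pow, mul_pow, mul_pow, Real.sq_sqrt (by positivity)]; ring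
  calc _ ≤ ∑ j ∈ Finset.range n, H.remainder j := H.integral_partialSum_le_sum hp hx hx1 n
    _ ≤ ∑ j ∈ Finset.range n, 30 * p ^ 2 / x * (v₀ / T) ^ 2 * T ^ p := by
        refine Finset.sum_le_sum fun j hj => H.remainder_le hp hx hv₀ hT ?_
        have hjn := Finset.mem_range.1 hj
        refine (ih j hjn).trans ?_
        rw [hTdef]
        have : (j : ℝ) ≤ n := by exact_mod_cast hjn.le
        gcongr
    _ = 5 / 6 * T ^ p := by
        rw [Finset.sum_const, Finset.card_range, nsmul_eq_mul, div_pow, hT2]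
        field_simp; norm_num
    _ ≤ T ^ p := by linarith [Real.rpow_pos_of_pos hT0 p]

end PoissonEnvelope

end Rio

/-! ### The quadratic function ψ -/

section Psi

variable {d : ℕ}

theorem inner_psi (f : EuclideanSpace ℝ (Fin d) → ℝ) (θs θ w : EuclideanSpace ℝ (Fin d)) :
    inner ℝ (psi f θs θ) w = 1 / 2 * iteratedFDeriv ℝ 3 f θs ![θ - θs, θ - θs, w] := by
  set T := iteratedFDeriv ℝ 3 f θs
  set l := T.toMultilinearMap.toLinearMap ![θ - θs, θ - θs, 0] 2
  have hl : ∀ u, l u = T ![θ - θs, θ - θs, u] := by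
    intro u
    change T (Function.update ![θ - θs, θ - θs, 0] 2 u) = _
    congr 1
    ext i : 1
    fin_cases i <;> rfl
  have hw : w = ∑ i, w i • EuclideanSpace.single i (1 : ℝ) := by
    have := (EuclideanSpace.basisFun (Fin d) ℝ).sum_repr w
    simpa using this.symm
  rw [← hl w]
  conv_rhs => rw [hw]
  rw [map_sum, Finset.mul_sum, PiLp.inner_apply]
  refine Finset.sum_congr rfl fun i _ => ?_
  rw [map_smul, hl]
  simp only [psi, smul_eq_mul, RCLike.inner_apply, conj_trivial]
  ring

/-- Testing ψ(θ) - ψ(θ') against itself, T[a,a] - T[b,b] = T[a-b,a] + T[b,a-b] gives the bound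
(L/2)‖a-b‖(‖a‖+‖b‖), with no symmetry of T needed. The arithmetic–geometric mean inequality then
introduces t. -/
theorem hasModulus_psi {f : EuclideanSpace ℝ (Fin d) → ℝ} {θs : EuclideanSpace ℝ (Fin d)}
    {L K : ℝ} (hL : ‖iteratedFDeriv ℝ 3 f θs‖ ≤ L) (hK : 0 ≤ K) :
    HasModulus θs K (L / 2) (psi f θs) := by
  intro t ht θ θ'
  set T := iteratedFDeriv ℝ 3 f θs with hT
  have hL0 : 0 ≤ L := (norm_nonneg _).trans hL
  set a := θ - θs with ha
  set b := θ' - θs with hb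
  have hab : θ - θ' = a - b := by rw [ha, hb]; abel
  have key : ‖psi f θs θ - psi f θs θ'‖ ≤ L / 2 * (‖a - b‖ * (‖a‖ + ‖b‖)) := by
    set w := psi f θs θ - psi f θs θ' with hw
    have bound : ∀ u v : EuclideanSpace ℝ (Fin d), T ![u, v, w] ≤ L * (‖u‖ * ‖v‖ * ‖w‖) := by
      intro u v
      refine (le_abs_self _).trans ((T.le_opNorm _).trans ?_)
      rw [Fin.prod_univ_three]
      exact mul_le_mul_of_nonneg_right hL (by positivity)
    have e1 : T ![a - b, a, w] = T ![a, a, w] - T ![b, a, w] := by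
      have := T.map_update_sub ![a, a, w] 0 a b
      convert this using 2 <;> [skip; congr 1; congr 1] <;> (ext i : 1; fin_cases i <;> rfl)
    have e2 : T ![b, a - b, w] = T ![b, a, w] - T ![b, b, w] := by
      have := T.map_update_sub ![b, a, w] 1 a b
      convert this using 2 <;> [skip; congr 1; congr 1] <;> (ext i : 1; fin_cases i <;> rfl)
    have h1 : ‖w‖ * ‖w‖ ≤ L / 2 * (‖a - b‖ * (‖a‖ + ‖b‖)) * ‖w‖ := by
      rw [← real_inner_self_eq_norm_mul_norm]
      conv_lhs => rw [hw]
      rw [← hw, inner_sub_left, inner_psi, inner_psi, ← hT, ← ha, ← hb]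
      have b1 := bound (a - b) a
      have b2 := bound b (a - b)
      rw [e1] at b1
      rw [e2] at b2
      linarith
    rcases (norm_nonneg w).eq_or_lt with h0 | h0
    · rw [← h0]; positivity
    · exact le_of_mul_le_mul_right h1 h0
  refine key.trans (mul_le_mul_of_nonneg_left ?_ (by positivity))
  rw [hab]
  have h2 : ‖a - b‖ * (‖a‖ + ‖b‖) ≤ t * ‖a - b‖ ^ 2 + (‖a‖ ^ 2 + ‖b‖ ^ 2) / t := by
    have h3 : 0 ≤ (t * ‖a - b‖ - (‖a‖ + ‖b‖) / 2) ^ 2 + (‖a‖ - ‖b‖) ^ 2 / 4 +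
      (‖a‖ ^ 2 + ‖b‖ ^ 2) / 2 := by positivity
    have h4 : t * ‖a - b‖ ^ 2 + (‖a‖ ^ 2 + ‖b‖ ^ 2) / t - ‖a - b‖ * (‖a‖ + ‖b‖) =
      ((t * ‖a - b‖ - (‖a‖ + ‖b‖) / 2) ^ 2 + (‖a‖ - ‖b‖) ^ 2 / 4 +
      (‖a‖ ^ 2 + ‖b‖ ^ 2) / 2) / t := by field_simp; ring
    have h5 := div_nonneg h3 ht.le
    linarith
  refine h2.trans (add_le_add le_rfl (div_le_div_of_nonneg_right ?_ ht.le))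
  linarith

end Psi

/-! ### Stationary moments and the bound in terms of x and s -/

section Stationary

variable {d : ℕ} {Z : Type*} [MeasurableSpace Z]

theorem integral_rpow_le_of_eLpNorm_sq_le {π : Measure (EuclideanSpace ℝ (Fin d))}
    {θs : EuclideanSpace ℝ (Fin d)} {q s : ℝ} (hq : 0 < q) (hs : 0 ≤ s)
    (hm : eLpNorm (fun θ => θ - θs) (ENNReal.ofReal q) π ^ 2 ≤ ENNReal.ofReal s) :
    MemLp (fun θ => θ - θs) (ENNReal.ofReal q) π ∧ ∫ θ, ‖θ - θs‖ ^ q ∂π ≤ s ^ (q / 2) := by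
  have hlt : eLpNorm (fun θ => θ - θs) (ENNReal.ofReal q) π < ⊤ := by
    by_contra h
    rw [not_lt, top_le_iff] at h
    simp [h] at hm
  have hM : MemLp (fun θ => θ - θs) (ENNReal.ofReal q) π := ⟨by fun_prop, hlt⟩
  refine ⟨hM, ?_⟩
  rw [hM.eLpNorm_eq_integral_rpow_norm (by simpa using hq) ENNReal.ofReal_ne_top,
    ENNReal.toReal_ofReal hq.le, ← ENNReal.ofReal_pow (by positivity),
    ENNReal.ofReal_le_ofReal_iff hs] at hm
  have h0 : 0 ≤ ∫ θ, ‖θ - θs‖ ^ q ∂π := integral_nonneg fun _ => by positivity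
  calc ∫ θ, ‖θ - θs‖ ^ q ∂π = (((∫ θ, ‖θ - θs‖ ^ q ∂π) ^ q⁻¹) ^ 2) ^ (q / 2) := by
        rw [← Real.rpow_natCast, ← Real.rpow_mul h0, ← Real.rpow_mul h0]
        have : q⁻¹ * (2 : ℕ) * (q / 2) = 1 := by field_simp; norm_num
        rw [this, Real.rpow_one]
    _ ≤ _ := by gcongr

theorem integral_sq_le_of_eLpNorm_sq_le {π : Measure (EuclideanSpace ℝ (Fin d))}
    [IsProbabilityMeasure π] {θs : EuclideanSpace ℝ (Fin d)} {q s : ℝ} (hq : 2 ≤ q) (hs : 0 ≤ s)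
    (hm : eLpNorm (fun θ => θ - θs) (ENNReal.ofReal q) π ^ 2 ≤ ENNReal.ofReal s) :
    ∫ θ, ‖θ - θs‖ ^ 2 ∂π ≤ s := by
  have h : eLpNorm (fun θ => θ - θs) (ENNReal.ofReal 2) π ^ 2 ≤ ENNReal.ofReal s := by
    refine le_trans ?_ hm
    gcongr
    exact eLpNorm_le_eLpNorm_of_exponent_le (ENNReal.ofReal_le_ofReal hq) (by fun_prop)
  simpa using (integral_rpow_le_of_eLpNorm_sq_le two_pos hs h).2

/-- Midpoint convexity of t^p makes the L^p norm of the envelope at most 2Bs. The envelope is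
quadratic, which is why moments of order 2p are required. -/
theorem integral_rpow_quadratic_le {π : Measure (EuclideanSpace ℝ (Fin d))}
    [IsProbabilityMeasure π] {θs : EuclideanSpace ℝ (Fin d)} {p s B : ℝ} (hp : 2 ≤ p) (hs : 0 ≤ s)
    (hB : 0 ≤ B)
    (hm : eLpNorm (fun θ => θ - θs) (ENNReal.ofReal (2 * p)) π ^ 2 ≤ ENNReal.ofReal s) :
    MemLp (fun θ => B * (‖θ - θs‖ ^ 2 + s)) (ENNReal.ofReal p) π ∧
      ∫ θ, (B * (‖θ - θs‖ ^ 2 + s)) ^ p ∂π ≤ (2 * B * s) ^ p := by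
  have hp0 : 0 < p := by linarith
  obtain ⟨hM, hI⟩ := integral_rpow_le_of_eLpNorm_sq_le (show 0 < 2 * p by linarith) hs hm
  have hi : Integrable (fun θ => ‖θ - θs‖ ^ (2 * p)) π :=
    hM.integrable_norm_rpow_ofReal (by linarith)
  have hsq : ∀ θ, (‖θ - θs‖ ^ 2) ^ p = ‖θ - θs‖ ^ (2 * p) := by
    intro θ
    rw [← Real.rpow_natCast, ← Real.rpow_mul (norm_nonneg _)]
    norm_num
  have hle : ∀ θ, (B * (‖θ - θs‖ ^ 2 + s)) ^ p ≤
      (2 * B) ^ p * (1 / 2 * ‖θ - θs‖ ^ (2 * p) + 1 / 2 * s ^ p) := by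
    intro θ
    have h := (convexOn_rpow (show 1 ≤ p by linarith)).2
      (show ‖θ - θs‖ ^ 2 ∈ Set.Ici 0 from Set.mem_Ici.2 (by positivity))
      (show s ∈ Set.Ici 0 from hs) (show (0 : ℝ) ≤ 1 / 2 by norm_num)
      (show (0 : ℝ) ≤ 1 / 2 by norm_num) (by norm_num)
    simp only [smul_eq_mul] at h
    rw [hsq] at h
    calc (B * (‖θ - θs‖ ^ 2 + s)) ^ p =
        (2 * B * (1 / 2 * ‖θ - θs‖ ^ 2 + 1 / 2 * s)) ^ p := by congr 1; ring
      _ = (2 * B) ^ p * (1 / 2 * ‖θ - θs‖ ^ 2 + 1 / 2 * s) ^ p :=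
          Real.mul_rpow (by positivity) (by positivity)
      _ ≤ _ := by gcongr
  have hi2 : Integrable (fun θ => (2 * B) ^ p * (1 / 2 * ‖θ - θs‖ ^ (2 * p) + 1 / 2 * s ^ p)) π :=
    ((hi.const_mul _).add (integrable_const _)).const_mul _
  have hmeas : Measurable fun θ => B * (‖θ - θs‖ ^ 2 + s) := by fun_prop
  have hi3 : Integrable (fun θ => (B * (‖θ - θs‖ ^ 2 + s)) ^ p) π :=
    hi2.mono' (hmeas.pow_const p).aestronglyMeasurable (Filter.Eventually.of_forall fun θ => by
      rw [Real.norm_of_nonneg (by positivity)]; exact hle θ)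
  constructor
  · rw [← integrable_norm_rpow_iff hmeas.aestronglyMeasurable (by simpa using hp0)
      ENNReal.ofReal_ne_top, ENNReal.toReal_ofReal hp0.le]
    refine hi3.congr (Filter.Eventually.of_forall fun θ => ?_)
    simp only
    rw [Real.norm_of_nonneg (by positivity)]
  · calc _ ≤ ∫ θ, (2 * B) ^ p * (1 / 2 * ‖θ - θs‖ ^ (2 * p) + 1 / 2 * s ^ p) ∂π :=
          integral_mono hi3 hi2 hle
      _ = (2 * B) ^ p * (1 / 2 * ∫ θ, ‖θ - θs‖ ^ (2 * p) ∂π + 1 / 2 * s ^ p) := by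
          rw [integral_const_mul, integral_add (hi.const_mul _) (integrable_const _),
            integral_const_mul]
          simp
      _ ≤ (2 * B) ^ p * (1 / 2 * s ^ p + 1 / 2 * s ^ p) := by
          rw [show 2 * p / 2 = p by ring] at hI
          gcongr
      _ = _ := by rw [Real.mul_rpow (by positivity) hs]; ring

variable {p x K L s γ : ℝ} {f : EuclideanSpace ℝ (Fin d) → ℝ}
  {G : EuclideanSpace ℝ (Fin d) → Z → EuclideanSpace ℝ (Fin d)} {P : Measure Z}
  [IsProbabilityMeasure P] {θs : EuclideanSpace ℝ (Fin d)}
  {π : Measure (EuclideanSpace ℝ (Fin d))} [IsProbabilityMeasure π]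

theorem memLp_id_of_eLpNorm_sq_le (hp : 2 ≤ p) (hs : 0 ≤ s)
    (hm : eLpNorm (fun θ => θ - θs) (ENNReal.ofReal (2 * p)) π ^ 2 ≤ ENNReal.ofReal s) :
    MemLp id 2 π := by
  have h := (integral_rpow_le_of_eLpNorm_sq_le (show 0 < 2 * p by linarith) hs hm).1
  have h2 : MemLp (fun θ => θ - θs) 2 π := h.mono_exponent (by
    simpa using ENNReal.ofReal_le_ofReal (show (2 : ℝ) ≤ 2 * p by linarith))
  refine (h2.add (memLp_const θs)).congr_norm (by fun_prop) (Filter.Eventually.of_forall fun θ => ?_)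
  simp

/-- The moment bound for stationary sums of `psi`, in terms of the contraction rate `x` of one step
and any positive upper bound `s` for the squared norm of `θ - θs` in `L^{2p}`. -/
theorem eLpNorm_sum_psi_le (hp : 2 ≤ p) (hS : ContractingStep (step G γ) P θs x K)
    (hG : Measurable (Function.uncurry G)) (hx : 0 < x) (hx1 : x ≤ 1) (hK : 0 ≤ K)
    (hKs : K ≤ 2 * s) (hs : 0 < s) (hL : 0 < L) (hf : ‖iteratedFDeriv ℝ 3 f θs‖ ≤ L)
    (hπ : (kernel G P γ).Invariant π)
    (hm : eLpNorm (fun θ => θ - θs) (ENNReal.ofReal (2 * p)) π ^ 2 ≤ ENNReal.ofReal s) (n : ℕ) :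
    eLpNorm (fun ω => ∑ k ∈ Finset.range n,
        (psi f θs (iterate G γ ω k) - ∫ θ, psi f θs θ ∂π)) (ENNReal.ofReal p)
        (canonicalMeasure π P) ≤
      ENNReal.ofReal (42 * p * Real.sqrt (n / x) * L * s) := by
  have hp0 : 0 < p := by linarith
  have hid := memLp_id_of_eLpNorm_sq_le hp hs.le hm
  have hψ := hasModulus_psi hf hK
  have hψi : Integrable (psi f θs) π := hψ.integrable_comp (by positivity) hid
  set h : EuclideanSpace ℝ (Fin d) → EuclideanSpace ℝ (Fin d) :=
    fun θ => psi f θs θ - ∫ θ, psi f θs θ ∂π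
  have hh : HasModulus θs K (L / 2) h := hψ.sub_const _
  have h0 : ∫ θ, h θ ∂π = 0 := by
    rw [integral_sub hψi (integrable_const _)]; simp
  have hsq := integral_sq_le_of_eLpNorm_sq_le (show 2 ≤ 2 * p by linarith) hs.le hm
  have hinv := Invariant.measurePreserving_step hG hπ
  have hgm := hS.hasModulus_poissonSum hx hx1 (by positivity) hK hh
  have hB : 0 ≤ 4 * (L / 2) / x := by positivity
  obtain ⟨hv, hvi⟩ := integral_rpow_quadratic_le hp hs.le (show 0 ≤ 7 * (L / 2) by positivity) hm
  have H : PoissonEnvelope G γ P π h (fun θ => 7 * (L / 2) * (‖θ - θs‖ ^ 2 + s)) p x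
      (2 * (7 * (L / 2)) * s) :=
    { measurable_G := hG
      measurePreserving_iterate := fun k => measurePreserving_iterate hG hπ k
      measurable_h := hh.continuous.measurable
      measurable_poisson := fun N => (hgm N).continuous.measurable
      integrable_poisson := fun N θ => (hgm N).integrable_comp hB (hS.memLp θ)
      norm_h_le := hh.norm_le_of_integral_eq_zero (by positivity) hid h0 hsq hKs
      norm_poisson_le := fun N θ => by
        refine ((hgm N).norm_le_of_integral_eq_zero hB hid
          (hS.integral_poissonSum hx hx1 (by positivity) hK hh hid hinv h0 N) hsq hKs θ).trans
          (le_of_eq ?_)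
        ring
      memLp_v := hv
      integral_v_le := hvi }
  have hmain := H.integral_partialSum_le hp hx hx1 (by positivity) n
  change eLpNorm (partialSum G γ h n) _ _ ≤ _
  rw [(H.memLp_partialSum n).eLpNorm_eq_integral_rpow_norm (by simpa using hp0)
    ENNReal.ofReal_ne_top, ENNReal.toReal_ofReal hp0.le]
  refine ENNReal.ofReal_le_ofReal ?_
  have hI0 : 0 ≤ ∫ ω, ‖partialSum G γ h n ω‖ ^ p ∂(canonicalMeasure π P) :=
    integral_nonneg fun _ => by positivity
  -- The envelope norm is 2 · 7 · (L/2) · s = 7Ls, so the constant is 6 · 7 = 42.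
  calc _ ≤ ((6 * p * Real.sqrt (n / x) * (2 * (7 * (L / 2)) * s)) ^ p) ^ p⁻¹ := by gcongr
    _ = 6 * p * Real.sqrt (n / x) * (2 * (7 * (L / 2)) * s) :=
        Real.rpow_rpow_inv (by positivity) hp0.ne'
    _ = _ := by ring

end Stationary

/-! ### Choice of parameters and conclusion -/

theorem sqrt_div_mul_div_eq {n γ μ : ℝ} (hγ : 0 < γ) (hμ : 0 < μ) (hn : 0 ≤ n) :
    Real.sqrt (n / (γ * μ)) * (γ / μ) = Real.sqrt (n * γ) / μ ^ (3 / 2 : ℝ) := by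
  have h1 : μ ^ (3 / 2 : ℝ) = μ * Real.sqrt μ := by
    rw [Real.sqrt_eq_rpow, show (3 / 2 : ℝ) = 1 + 1 / 2 by norm_num, Real.rpow_add hμ,
      Real.rpow_one]
  have h2 : n / (γ * μ) = n * γ / (γ ^ 2 * μ) := by field_simp
  rw [h1, h2, Real.sqrt_div (by positivity), Real.sqrt_mul (sq_nonneg γ), Real.sqrt_sq hγ.le]
  have := Real.sqrt_pos.2 hμ
  field_simp

end SGD

open SGD in
theorem mainTheorem6 :
    ∃ c₀ : ℝ, 0 < c₀ ∧
      ∀ (p : ℝ), 2 ≤ p →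
      ∀ (d : ℕ) (Z : Type*) [MeasurableSpace Z] (P : Measure Z) [IsProbabilityMeasure P]
        (f : EuclideanSpace ℝ (Fin d) → ℝ)
        (G : EuclideanSpace ℝ (Fin d) → Z → EuclideanSpace ℝ (Fin d))
        (θstar : EuclideanSpace ℝ (Fin d)) (μ L₁ L₂ L₃ L₄ L τ D C : ℝ),
        (∀ θ, f θstar ≤ f θ) →
        L = max (max L₁ L₂) (max L₃ L₄) →
        SGD.StronglyConvex f μ →
        SGD.Smooth f L₂ L₃ L₄ →
        SGD.NoiseCondition (2 * p) f G P θstar L₁ τ →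
        SGD.MomentCondition (2 * p) G P θstar μ L τ D C →
        ∀ γ : ℝ, 0 < γ → γ ≤ 1 / (L * C) →
        ∀ π : Measure (EuclideanSpace ℝ (Fin d)), IsProbabilityMeasure π →
          (SGD.kernel G P γ).Invariant π →
          Integrable (SGD.psi f θstar) π ∧
          ∀ n : ℕ,
            eLpNorm
                (fun ω => ∑ k ∈ Finset.range n,
                  (SGD.psi f θstar (SGD.iterate G γ ω k) - ∫ θ, SGD.psi f θstar θ ∂π))
                (ENNReal.ofReal p) (SGD.canonicalMeasure π P) ≤
              ENNReal.ofReal (c₀ *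
                (L * D * p * τ ^ 2 * Real.sqrt (n * γ) / μ ^ (3 / 2 : ℝ) +
                  L * D * τ / μ ^ 2)) := by
  refine ⟨42, by norm_num, ?_⟩
  intro p hp d Z _ P _ f G θs μ L₁ L₂ L₃ L₄ L τ D C hmin hLdef hf hsm hN hM γ hγ hγL π _ hπ
  have hL₁ : L₁ ≤ L := by rw [hLdef]; simp
  have hL₂ : L₂ ≤ L := by rw [hLdef]; simp
  have hL₃ : L₃ ≤ L := by rw [hLdef]; simp
  have hL : 0 < L := hN.L₁_pos.trans_le hL₁
  have hμ := hf.pos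
  have hC : 0 < C := by linarith [hM.two_le_C]
  have hD : 0 < D := by linarith [hM.two_le_D]
  have hγL2 : γ * L ≤ 1 / 2 := by
    rw [le_div_iff₀ (by positivity)] at hγL
    nlinarith [mul_le_mul_of_nonneg_left hM.two_le_C (mul_nonneg hγ.le hL.le)]
  have hm := hM.stationary_bound γ hγ hγL π inferInstance hπ
  have hs₀ : 0 ≤ D * γ * τ ^ 2 / μ := by positivity
  have h3 : ‖iteratedFDeriv ℝ 3 f θs‖ ≤ L := (hsm.third_derivative_le θs).trans hL₃
  refine ⟨(hasModulus_psi h3 le_rfl).integrable_comp (by positivity)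
    (memLp_id_of_eLpNorm_sq_le hp hs₀ hm), fun n => ?_⟩
  -- Dimension zero is separated because μ ≤ L, needed for γμ ≤ 1, is read off from a nonzero
  -- vector.
  rcases subsingleton_or_nontrivial (EuclideanSpace ℝ (Fin d)) with hsub | hnon
  · rw [Subsingleton.elim (fun ω => ∑ k ∈ Finset.range n,
      (psi f θs (iterate G γ ω k) - ∫ θ, psi f θs θ ∂π)) 0, eLpNorm_zero]
    exact zero_le
  have hμL : μ ≤ L := by
    obtain ⟨e, he⟩ := exists_ne (0 : EuclideanSpace ℝ (Fin d))
    have h1 := hf.inner_ge e 0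
    have h2 := (real_inner_le_norm _ _).trans
      (mul_le_mul_of_nonneg_right (hsm.gradient_lipschitz e 0) (norm_nonneg (e - 0)))
    rw [sub_zero] at h1 h2
    have h4 : 0 < ‖e‖ ^ 2 := by positivity
    have h5 : μ * ‖e‖ ^ 2 ≤ L₂ * ‖e‖ ^ 2 := by linarith
    exact (le_of_mul_le_mul_right h5 h4).trans hL₂
  have hx : 0 < γ * μ := by positivity
  have hx1 : γ * μ ≤ 1 := by
    have : γ * μ ≤ γ * L := by gcongr
    linarith
  have hS := hN.contractingStep (by linarith) hf hmin hL₁ hγ hγL2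
  -- D ≥ 2 makes the drift level at most twice the stationary moment bound.
  have hK : 4 * γ * τ ^ 2 / μ ≤ 2 * (D * γ * τ ^ 2 / μ) := by
    rw [← mul_div_assoc]
    refine div_le_div_of_nonneg_right ?_ hμ.le
    nlinarith [mul_le_mul_of_nonneg_right hM.two_le_D (mul_nonneg hγ.le (sq_nonneg τ))]
  have hlim : eLpNorm (fun ω => ∑ k ∈ Finset.range n,
      (psi f θs (iterate G γ ω k) - ∫ θ, psi f θs θ ∂π)) (ENNReal.ofReal p)
      (canonicalMeasure π P) ≤
      ENNReal.ofReal (42 * p * Real.sqrt (n / (γ * μ)) * L * (D * γ * τ ^ 2 / μ)) := by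
    -- The moment argument divides by v₀ and so needs s > 0, whereas Dγτ²/μ vanishes when τ = 0; the
    -- bound is obtained as s decreases to this value.
    have hcont : Continuous fun s : ℝ =>
        ENNReal.ofReal (42 * p * Real.sqrt (n / (γ * μ)) * L * s) :=
      ENNReal.continuous_ofReal.comp (by fun_prop)
    refine ge_of_tendsto (hcont.continuousWithinAt (s := Set.Ioi (D * γ * τ ^ 2 / μ))
      (x := D * γ * τ ^ 2 / μ)) ?_
    filter_upwards [self_mem_nhdsWithin] with s hs
    have hs' : D * γ * τ ^ 2 / μ < s := hs
    exact eLpNorm_sum_psi_le hp hS hN.measurable hx hx1 (by positivity) (by linarith)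
      (by linarith) hL h3 hπ (hm.trans (ENNReal.ofReal_le_ofReal hs'.le)) n
  refine hlim.trans (ENNReal.ofReal_le_ofReal ?_)
  have e : 42 * p * Real.sqrt (n / (γ * μ)) * L * (D * γ * τ ^ 2 / μ) =
      42 * (L * D * p * τ ^ 2 * Real.sqrt (n * γ) / μ ^ (3 / 2 : ℝ)) := by
    rw [mul_div_assoc (L * D * p * τ ^ 2), ← sqrt_div_mul_div_eq hγ hμ (Nat.cast_nonneg n)]
    ring
  rw [e]
  -- The first term alone already dominates; the second is nonnegative and only enlarges the bound.
  have hτ := hN.τ_nonneg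
  have : 0 ≤ L * D * τ / μ ^ 2 := by positivity
  linarith
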